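/- Let $A$ be a finite alphabet with at least two symbols and let $M$ be an irreducible $A\times A$ matrix with entries in $\{0,1\}$. Let $X=X_M$ be the irreducible shift of finite type of all one-sided sequences $x_1x_2x_3\cdots$ over $A$ with $M_{x_ix_{i+1}}=1$ for every $i\ge 1$. Its Parry measure $\mu^X$ is the Markov measure $$\mu^X(a_1\cdots a_k)=\pi_{a_1}P_{a_1a_2}\cdots P_{a_{k-1}a_k},\qquad P_{ab}=\frac{M_{ab}\,r_b}{\lambda\, r_a},\qquad \pi_a=l_ar_a ,$$ where $\lambda$ is the Perron eigenvalue of $M$ and $l$, $r$ are positive left and right eigenvectors of $M$ for $\lambda$ with $\sum_a l_ar_a=1$. A sequence $x\in X$ is *normal in $X$* if for each $\ell\ge 1$ and each word $w\in A^\ell$, $$\lim_{n\to\infty}\frac1n\,\bigl|\{\,0\le j<n : x_{j\ell+1}\cdots x_{j\ell+\ell}=w\,\}\bigr|=\mu^X(w),$$ and *normal in $X$ for non-aligned occurrences* if for each word $w\in A^*$ the number of occurrences of $w$ at arbitrary positions in $x_1\cdots x_n$, divided by $n$, tends to $\mu^X(w)$ as $n\to\infty$. A *transducer* is given by a finite set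 $Q$ of states, sets of initial and of final states, and a finite set of transitions $p\xrightarrow{a|v}q$ with $p,q\in Q$, $a\in A$, $v\in A^*$. An infinite run $q_0\xrightarrow{a_1|v_1}q_1\xrightarrow{a_2|v_2}q_2\cdots$ has input label $a_1a_2\cdots$ and output label $v_1v_2\cdots$; it is accepting if $q_0$ is initial and $q_n$ is final for infinitely many $n$. A *compressor* from $X$ to $X$ is a transducer $\mathcal C$ such that: each state occurs in some accepting run; each $x\in X$ is the input label of at most one accepting run, and the output label of such a run is an infinite sequence in $X$, denoted $\mathcal C(x)$; and $\mathcal C$ is bounded-to-one, that is, there is a constant $K$ such that each sequence $y$ equals $\mathcal C(x)$ for at most $K$ sequences $x\in X$. A sequence $x\in X$ is *compressible in $X$* if there is a compressor from $X$ to $X$ with an accepting run with input label $x$ and outputs $v_1,v_2,\dots$ such that $$\liminf_{n\to\infty}\frac{|v_1\cdots v_n|}{n}<1 ,$$ and *incompressible in $X$* otherwise. Theorem. Let $x\in X$. 1. If $X$ is moreover aperiodic (some power $M^n$ with $n\ge1$ has only positive entries), then $x$ is normal in $X$ if and only if $x$ is incompressible in $X$. 2. If $X$ is infinite (periodic or not),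 then $x$ is normal in $X$ for non-aligned occurrences if and only if $x$ is incompressible in $X$. -/

import Mathlib

open Filter Topology

namespace NormalSFT

/-! ### Words and sequences

Sequences over `A` are functions `ℕ → A` (positions are counted from `0`), words are lists. -/

/-- The prefix of length `n` of the sequence `x`. -/
def seqPrefix {A : Type*} (x : ℕ → A) (n : ℕ) : List A :=
  (List.range n).map x

/-- The number of occurrences of the word `u` in the word `w`. -/
def occ {A : Type*} [DecidableEq A] (w u : List A) : ℕ :=
  ((Finset.range (w.length + 1)).filter (fun i => u <+: w.drop i)).card

/-- The number of aligned occurrences of `u` in `w`: the occurrences that start at a position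
which is (counting positions from `0`) a multiple of the length of `u`. -/
def alignedOcc {A : Type*} [DecidableEq A] (w u : List A) : ℕ :=
  ((Finset.range (w.length + 1)).filter (fun i => u.length ∣ i ∧ u <+: w.drop i)).card

/-! ### Shifts of finite type and the Parry measure -/

/-- The shift of finite type `X_M` of a matrix `M` with entries `0` and `1`: the one-sided
sequences all of whose blocks `ab` of length two satisfy `M a b = 1`. -/
def sft {A : Type*} (M : Matrix A A ℝ) : Set (ℕ → A) :=
  {x | ∀ i, M (x i) (x (i + 1)) = 1}

/-- `P a b₁ * P b₁ b₂ * ⋯`, the product of the transition probabilities along `a b₁ b₂ ⋯`. -/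
def pathProb {A : Type*} (P : Matrix A A ℝ) : A → List A → ℝ
  | _, [] => 1
  | a, b :: w => P a b * pathProb P b w

/-- The Markov measure of a distribution `π` and a stochastic matrix `P`, as a function on words:
`a₁ ⋯ aₖ ↦ π a₁ * P a₁ a₂ * ⋯ * P aₖ₋₁ aₖ`. -/
def markovMeasure {A : Type*} (π : A → ℝ) (P : Matrix A A ℝ) : List A → ℝ
  | [] => 1
  | a :: w => π a * pathProb P a w

/-- `μ` is the Parry measure of `X_M`: the Markov measure with `π a = l a * r a` and
`P a b = M a b * r b / (lam * r a)`, where `lam` is the Perron eigenvalue of `M` and `l`, `r` are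
positive left and right eigenvectors for `lam` with `∑ a, l a * r a = 1`.  (For an irreducible `M`,
an eigenvalue with a positive eigenvector is the Perron eigenvalue.) -/
def IsParryMeasure {A : Type*} [Fintype A] (M : Matrix A A ℝ) (μ : List A → ℝ) : Prop :=
  ∃ (lam : ℝ) (l r : A → ℝ), 0 < lam ∧ (∀ a, 0 < l a) ∧ (∀ a, 0 < r a) ∧
    (∀ a, ∑ b, M a b * r b = lam * r a) ∧
    (∀ b, ∑ a, l a * M a b = lam * l b) ∧
    ∑ a, l a * r a = 1 ∧
    μ = markovMeasure (fun a => l a * r a) (fun a b => M a b * r b / (lam * r a))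

/-- Normality of `x` in `X_M` through aligned occurrences: for each `ℓ ≥ 1`, each word of length
`ℓ` has aligned frequency in `x` equal to its Parry measure. -/
def IsNormal {A : Type*} [Fintype A] [DecidableEq A] (M : Matrix A A ℝ) (x : ℕ → A) : Prop :=
  ∃ μ : List A → ℝ, IsParryMeasure M μ ∧ ∀ ℓ : ℕ, 1 ≤ ℓ → ∀ w : List A, w.length = ℓ →
    Tendsto (fun n : ℕ => (alignedOcc (seqPrefix x (n * ℓ)) w : ℝ) / n) atTop (𝓝 (μ w))

/-- Normality of `x` in `X_M` through all (not only aligned) occurrences: each word has frequency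
in `x` equal to its Parry measure. -/
def IsNonAlignedNormal {A : Type*} [Fintype A] [DecidableEq A] (M : Matrix A A ℝ)
    (x : ℕ → A) : Prop :=
  ∃ μ : List A → ℝ, IsParryMeasure M μ ∧ ∀ w : List A,
    Tendsto (fun n : ℕ => (occ (seqPrefix x n) w : ℝ) / n) atTop (𝓝 (μ w))

/-! ### Transducers -/

/-- A non-deterministic real-time transducer with states `Q`, input alphabet `A` and output
alphabet `B`. -/
structure Transducer (Q A B : Type*) where
  /-- the transitions `p --a|v--> q` -/
  trans : Set (Q × A × List B × Q)
  finite_trans : trans.Finite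
  /-- the initial states -/
  initial : Set Q
  /-- the final states -/
  final : Set Q

/-- The concatenation of the first `n` of the words `v 0, v 1, …`. -/
def concatPrefix {B : Type*} (v : ℕ → List B) (n : ℕ) : List B :=
  ((List.range n).map v).flatten

/-- The infinite sequence `y` is the concatenation of the words `v 0, v 1, …`. -/
def IsConcat {B : Type*} (v : ℕ → List B) (y : ℕ → B) : Prop :=
  Tendsto (fun n => (concatPrefix v n).length) atTop atTop ∧
    ∀ n, concatPrefix v n = seqPrefix y (concatPrefix v n).length

namespace Transducer

variable {Q A B : Type*}

/-- `q 0 --x 0|v 0--> q 1 --x 1|v 1--> q 2 ⋯` is an accepting run: an infinite run from an initial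
state that visits final states infinitely often (Büchi acceptance). -/
def IsAcceptingRun (T : Transducer Q A B) (q : ℕ → Q) (x : ℕ → A) (v : ℕ → List B) : Prop :=
  q 0 ∈ T.initial ∧ (∀ n, (q n, x n, v n, q (n + 1)) ∈ T.trans) ∧ ∃ᶠ n in atTop, q n ∈ T.final

/-- `y = T(x)`: there is an accepting run with input label `x` and output label `y`. -/
def Realizes (T : Transducer Q A B) (x : ℕ → A) (y : ℕ → B) : Prop :=
  ∃ q v, T.IsAcceptingRun q x v ∧ IsConcat v y

/-- Each state occurs in an accepting run. -/
def IsTrim (T : Transducer Q A B) : Prop :=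
  ∀ s : Q, ∃ q x v, T.IsAcceptingRun q x v ∧ ∃ n, q n = s

/-- `T` computes a (partial) function from `X` to `Y`: each sequence of `X` is the input label of at
most one accepting run, and the output label of such a run is an infinite sequence in `Y`. -/
def ComputesFunction (T : Transducer Q A B) (X : Set (ℕ → A)) (Y : Set (ℕ → B)) : Prop :=
  (∀ x ∈ X, ∀ q v q' v', T.IsAcceptingRun q x v → T.IsAcceptingRun q' x v' → q = q' ∧ v = v') ∧
    ∀ x ∈ X, ∀ q v, T.IsAcceptingRun q x v → ∃ y ∈ Y, IsConcat v y

/-- The function computed by `T` on `X` is bounded-to-one. -/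
def IsBoundedToOne (T : Transducer Q A B) (X : Set (ℕ → A)) : Prop :=
  ∃ K : ℕ, ∀ y : ℕ → B, {x | x ∈ X ∧ T.Realizes x y}.encard ≤ K

/-- `T` is a compressor from `X` to `Y`: a trim bounded-to-one transducer from `X` to `Y`. -/
def IsCompressor (T : Transducer Q A B) (X : Set (ℕ → A)) (Y : Set (ℕ → B)) : Prop :=
  T.IsTrim ∧ T.ComputesFunction X Y ∧ T.IsBoundedToOne X

end Transducer

/-- The lower limit of the number of output symbols per input symbol, along a run with outputs
`v 0, v 1, …`.  (As a transducer has finitely many transitions, the quotients are bounded.) -/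
noncomputable def compressionRatio {B : Type*} (v : ℕ → List B) : ℝ :=
  liminf (fun n : ℕ => ((concatPrefix v n).length : ℝ) / n) atTop

/-- `x` is compressible in `X`: some compressor from `X` to `X` has an accepting run with input
label `x`, whose compression ratio is less than `1`. -/
def IsCompressible {A : Type*} (X : Set (ℕ → A)) (x : ℕ → A) : Prop :=
  ∃ (Q : Type) (_ : Finite Q) (T : Transducer Q A A), T.IsCompressor X X ∧
    ∃ q v, T.IsAcceptingRun q x v ∧ compressionRatio v < 1

/-- `x` is incompressible in `X`. -/
def IsIncompressible {A : Type*} (X : Set (ℕ → A)) (x : ℕ → A) : Prop :=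
  ¬ IsCompressible X x

end NormalSFT

/-!
Let `lam > 1` be the Perron eigenvalue of `M`, `r` a positive right eigenvector, and `P` the
transition matrix of the Parry measure. Up to constant factors, the number of paths of length `n`
is `lam ^ n` and the Parry measure of each of them is `lam ^ (-n)`. Everything rests on this
uniformity.

A normal sequence `x` is incompressible (`IsPerron.isIncompressible`). In a run of a bounded-to-one
transducer, two factors of `x` with the same output, the same end states and the same letters at
their ends can replace each other without changing the output of the run, so there are boundedly
many such factors for each output word (`exists_card_compressed_factors_le`). Hence the factors of
length `N` whose output is shorter than `(1 - ε) N` are `O(N lam ^ ((1 - ε) N))` in number, their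
Parry measure tends to `0` as `N` grows, and by normality they are rare in `x`. All other windows
of `x` have an output of length at least `(1 - ε) N`.

An incompressible sequence is normal. For a word `w` and a letter `b`, the differences between the
indicator of an occurrence of `w b` and its conditional expectation given an occurrence of `w` are
orthogonal, so their sum over a path of length `N` has second moment `O(N)`
(`sum_pathProb_mul_pathSum_sq_le`). By Chebyshev's inequality all but `O(lam ^ N / N)` of the paths
have a small average deviation. If the average deviation along `x` does not tend to `0`, then a
proportion at least `ε` of the blocks of `x` of any fixed length `N` lies in this small exceptional
set. Loops at a fixed letter can be concatenated freely, and there are enough of them for a prefix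
code that encodes the exceptional blocks by loops shorter than `N` by a large constant, at the cost
of a constant number of letters for each other block (`IsPerron.exists_loop_code`). As that cost
does not depend on `N`, the block transducer of the code compresses `x`
(`IsPerron.tendsto_deviation`). So the average deviations tend to `0`: asymptotically, the
frequencies of words are governed by `P`. The letter frequencies then converge to the unique
invariant distribution (`tendsto_freq`).

Occurrences are counted at the positions divisible by `d`. The case `d = 1` concerns all
occurrences, and the case where `d` is the length of the word the aligned ones; the latter needs
the irreducibility of `P ^ d`, which holds if `M` is primitive.
-/

namespace NormalSFT

/-! ### Perron eigenvectors of irreducible matrices -/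

section Perron

variable {A : Type*} [Fintype A] [DecidableEq A]

/-- A matrix with positive entries that commutes with `M`. -/
theorem exists_sum_pow_pos {M : Matrix A A ℝ} (hirr : M.IsIrreducible) :
    ∃ m : ℕ, ∀ a b, 0 < (∑ k ∈ Finset.range m, M ^ k) a b := by
  have h := (Matrix.isIrreducible_iff_exists_pow_pos hirr.nonneg).1 hirr
  choose k _ hk using h
  refine ⟨(Finset.univ.sup fun p : A × A => k p.1 p.2) + 1, fun a b => ?_⟩
  rw [Matrix.sum_apply]
  refine Finset.sum_pos' (fun i _ => Matrix.pow_apply_nonneg hirr.nonneg i a b)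
    ⟨k a b, Finset.mem_range.2 (Nat.lt_succ_of_le ?_), hk a b⟩
  exact Finset.le_sup (f := fun p : A × A => k p.1 p.2) (Finset.mem_univ (a, b))

/-- If `t` is the largest number with `t v ≤ M v` for some probability vector `v` (the
Collatz–Wielandt number), then such a `v` is an eigenvector: otherwise a positive power sum of `M`,
applied to `v`, would give a vector that admits a larger `t`. -/
theorem exists_pos_eigenvector [Nontrivial A] {M : Matrix A A ℝ} (hirr : M.IsIrreducible) :
    ∃ (lam : ℝ) (r : A → ℝ), 0 < lam ∧ (∀ a, 0 < r a) ∧ ∀ a, ∑ b, M a b * r b = lam * r a := by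
  obtain ⟨m, hm⟩ := exists_sum_pow_pos hirr
  set B : Matrix A A ℝ := ∑ k ∈ Finset.range m, M ^ k with hB
  have hcomm : M * B = B * M :=
    (Commute.sum_right _ _ _ fun k _ => (Commute.refl M).pow_right k : Commute M B)
  set C : ℝ := ∑ a, ∑ b, M a b with hC
  let S : Set (ℝ × (A → ℝ)) :=
    {p | p.1 ∈ Set.Icc 0 C ∧ p.2 ∈ stdSimplex ℝ A ∧ ∀ a, p.1 * p.2 a ≤ (M.mulVec p.2) a}
  have hbound : ∀ t : ℝ, ∀ v ∈ stdSimplex ℝ A, (∀ a, t * v a ≤ (M.mulVec v) a) → t ≤ C := by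
    intro t v hv h
    have hv1 : ∀ b, v b ≤ 1 := fun b =>
      hv.2 ▸ Finset.single_le_sum (fun i _ => hv.1 i) (Finset.mem_univ b)
    calc t = ∑ a, t * v a := by rw [← Finset.mul_sum, hv.2, mul_one]
      _ ≤ ∑ a, ∑ b, M a b * v b := Finset.sum_le_sum fun a _ => h a
      _ ≤ C := Finset.sum_le_sum fun a _ => Finset.sum_le_sum fun b _ =>
          mul_le_of_le_one_right (hirr.nonneg a b) (hv1 b)
  have hcpt : IsCompact S := by
    have hK : IsCompact (Set.Icc (0 : ℝ) C ×ˢ stdSimplex ℝ A) :=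
      isCompact_Icc.prod (isCompact_stdSimplex ℝ A)
    have hcl : IsClosed {p : ℝ × (A → ℝ) | ∀ a, p.1 * p.2 a ≤ (M.mulVec p.2) a} := by
      simp only [Set.ofPred_forall, Matrix.mulVec, dotProduct]
      refine isClosed_iInter fun a => isClosed_le (by fun_prop) (by fun_prop)
    convert hK.inter_right hcl using 1
    ext p
    simp [S, and_assoc]
  have hne : S.Nonempty := by
    obtain ⟨a₀⟩ : Nonempty A := inferInstance
    have hs := single_mem_stdSimplex ℝ a₀
    refine ⟨(0, Pi.single a₀ 1), ⟨le_rfl, ?_⟩, hs, fun a => ?_⟩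
    · exact Finset.sum_nonneg fun a _ => Finset.sum_nonneg fun b _ => hirr.nonneg a b
    · rw [zero_mul]
      exact Finset.sum_nonneg fun b _ => mul_nonneg (hirr.nonneg a b) (hs.1 b)
  obtain ⟨⟨t, v⟩, ⟨ht, hv, hle⟩, hmax⟩ := hcpt.exists_isMaxOn hne continuous_fst.continuousOn
  simp only at ht hv hle
  have hBpos : ∀ z : A → ℝ, (∀ a, 0 ≤ z a) → (∃ a, 0 < z a) → ∀ a, 0 < (B.mulVec z) a := by
    rintro z hz ⟨b, hb⟩ a
    exact Finset.sum_pos' (fun i _ => mul_nonneg (hm a i).le (hz i))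
      ⟨b, Finset.mem_univ b, mul_pos (hm a b) hb⟩
  have hvpos : ∃ a, 0 < v a := by
    by_contra! h
    have : ∑ a, v a ≤ 0 := Finset.sum_nonpos fun a _ => h a
    linarith [hv.2]
  have hw : ∀ a, 0 < (B.mulVec v) a := hBpos v hv.1 hvpos
  have heig : M.mulVec v = t • v := by
    by_contra hcon
    set z : A → ℝ := M.mulVec v - t • v with hz
    have hz0 : ∀ a, 0 ≤ z a := fun a => by simpa [hz] using hle a
    have hz1 : ∃ a, 0 < z a := by
      by_contra! h
      exact hcon (sub_eq_zero.1 (funext fun a => le_antisymm (h a) (hz0 a)))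
    have hBz := hBpos z hz0 hz1
    set w : A → ℝ := B.mulVec v with hwdef
    have hMw : M.mulVec w - t • w = B.mulVec z := by
      rw [hz, Matrix.mulVec_sub, Matrix.mulVec_smul, hwdef, Matrix.mulVec_mulVec,
        Matrix.mulVec_mulVec, hcomm]
    obtain ⟨a₁, -, ha₁⟩ := Finset.exists_min_image Finset.univ
      (fun a => (B.mulVec z) a / w a) Finset.univ_nonempty
    set ε := (B.mulVec z) a₁ / w a₁ with hε
    have hε0 : 0 < ε := div_pos (hBz a₁) (hw a₁)
    have hkey : ∀ a, (t + ε) * w a ≤ (M.mulVec w) a := by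
      intro a
      have h1 : ε * w a ≤ (B.mulVec z) a := (le_div_iff₀ (hw a)).1 (ha₁ a (Finset.mem_univ a))
      have h2 := congrFun hMw a
      simp only [Pi.sub_apply, Pi.smul_apply, smul_eq_mul] at h2
      linarith
    have hs : 0 < ∑ a, w a := Finset.sum_pos (fun a _ => hw a) Finset.univ_nonempty
    set u : A → ℝ := (∑ a, w a)⁻¹ • w with hu
    have hus : u ∈ stdSimplex ℝ A := by
      refine ⟨fun a => mul_nonneg (inv_nonneg.2 hs.le) (hw a).le, ?_⟩
      simp only [hu, Pi.smul_apply, smul_eq_mul, ← Finset.mul_sum]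
      exact inv_mul_cancel₀ hs.ne'
    have hule : ∀ a, (t + ε) * u a ≤ (M.mulVec u) a := by
      intro a
      rw [hu, Matrix.mulVec_smul, Pi.smul_apply, Pi.smul_apply, smul_eq_mul, smul_eq_mul,
        mul_left_comm]
      exact mul_le_mul_of_nonneg_left (hkey a) (inv_nonneg.2 hs.le)
    have := hmax (a := (t + ε, u)) ⟨⟨by linarith [ht.1], hbound _ u hus hule⟩, hus, hule⟩
    simp only [Set.mem_ofPred_eq] at this
    linarith
  have hpow : ∀ k : ℕ, (M ^ k).mulVec v = t ^ k • v := by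
    intro k
    induction k with
    | zero => simp
    | succ k ih => rw [pow_succ, ← Matrix.mulVec_mulVec, heig, Matrix.mulVec_smul, ih, smul_smul,
        pow_succ, mul_comm]
  have hvp : ∀ a, 0 < v a := by
    intro a
    refine lt_of_le_of_ne (hv.1 a) fun h => ?_
    have h1 := hw a
    rw [hB, Matrix.sum_mulVec, Finset.sum_apply] at h1
    simp [hpow, ← h] at h1
  have heig' : ∀ a, ∑ b, M a b * v b = t * v a := fun a => congrFun heig a
  refine ⟨t, v, lt_of_le_of_ne ht.1 fun h => ?_, hvp, heig'⟩
  obtain ⟨a⟩ : Nonempty A := inferInstance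
  obtain ⟨b, hb⟩ := hirr.exists_pos a
  have : 0 < ∑ b, M a b * v b := Finset.sum_pos' (fun i _ => mul_nonneg (hirr.nonneg a i) (hv.1 i))
      ⟨b, Finset.mem_univ b, mul_pos hb (hvp b)⟩
  rw [heig' a, ← h, zero_mul] at this
  exact this.false

theorem exists_isParryMeasure [Nontrivial A] {M : Matrix A A ℝ} (hirr : M.IsIrreducible) :
    ∃ μ, IsParryMeasure M μ := by
  obtain ⟨lam, r, hlam, hr, hMr⟩ := exists_pos_eigenvector hirr
  obtain ⟨lam', l, -, hl, hMl⟩ := exists_pos_eigenvector hirr.transpose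
  have hs : 0 < ∑ a, l a * r a :=
    Finset.sum_pos (fun a _ => mul_pos (hl a) (hr a)) Finset.univ_nonempty
  -- both eigenvalues are equal, since both are the factor of `l ⬝ M r = l M ⬝ r` over `l ⬝ r`
  have hll : lam' = lam := by
    have h1 : ∑ a, ∑ b, l a * (M a b * r b) = lam * ∑ a, l a * r a := by
      simp_rw [← Finset.mul_sum, hMr, Finset.mul_sum]
      exact Finset.sum_congr rfl fun a _ => by ring
    have h2 : ∑ a, ∑ b, l a * (M a b * r b) = lam' * ∑ a, l a * r a := by
      rw [Finset.sum_comm, Finset.mul_sum]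
      refine Finset.sum_congr rfl fun b _ => ?_
      rw [← mul_assoc, ← hMl b, Finset.sum_mul]
      exact Finset.sum_congr rfl fun a _ => by rw [Matrix.transpose_apply]; ring
    exact mul_right_cancel₀ hs.ne' (h2.symm.trans h1)
  subst hll
  refine ⟨_, lam', fun a => l a / ∑ a, l a * r a, r, hlam, fun a => div_pos (hl a) hs, hr, hMr,
    fun b => ?_, ?_, rfl⟩
  · have := hMl b
    simp only [Matrix.transpose_apply] at this
    rw [mul_div_assoc', ← this, Finset.sum_div]
    exact Finset.sum_congr rfl fun a _ => by ring
  · simp_rw [div_mul_eq_mul_div, ← Finset.sum_div]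
    exact div_self hs.ne'

end Perron

/-! ### Words, windows of sequences, and paths -/

section Words

variable {A : Type*}

/-- The word `x i, x (i + 1), …, x (i + n - 1)`. -/
def window (x : ℕ → A) (i n : ℕ) : List A :=
  (List.range n).map fun t => x (i + t)

@[simp]
theorem length_window (x : ℕ → A) (i n : ℕ) : (window x i n).length = n := by
  simp [window]

@[simp]
theorem window_zero (x : ℕ → A) (i : ℕ) : window x i 0 = [] := rfl

theorem window_succ (x : ℕ → A) (i n : ℕ) : window x i (n + 1) = window x i n ++ [x (i + n)] := by
  simp [window, List.range_succ]

theorem window_add (x : ℕ → A) (i m n : ℕ) :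
    window x i (m + n) = window x i m ++ window x (i + m) n := by
  simp [window, List.range_add, Function.comp_def, add_assoc]

@[simp]
theorem getElem_window (x : ℕ → A) (i n t : ℕ) (h : t < (window x i n).length) :
    (window x i n)[t] = x (i + t) := by
  simp [window]

theorem seqPrefix_eq_window (x : ℕ → A) (n : ℕ) : seqPrefix x n = window x 0 n := by
  simp [seqPrefix, window]

theorem take_window (x : ℕ → A) (i : ℕ) {m n : ℕ} (h : m ≤ n) :
    (window x i n).take m = window x i m := by
  obtain ⟨k, rfl⟩ := Nat.exists_eq_add_of_le h
  rw [window_add, List.take_left' (length_window x i m)]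

theorem drop_window (x : ℕ → A) (i : ℕ) {m n : ℕ} (h : m ≤ n) :
    (window x i n).drop m = window x (i + m) (n - m) := by
  obtain ⟨k, rfl⟩ := Nat.exists_eq_add_of_le h
  rw [window_add, List.drop_left' (length_window x i m), Nat.add_sub_cancel_left]

theorem prefix_window_iff (x : ℕ → A) (i n : ℕ) (w : List A) :
    w <+: window x i n ↔ w.length ≤ n ∧ window x i w.length = w := by
  constructor
  · intro h
    have hl : w.length ≤ n := by simpa using h.length_le
    exact ⟨hl, by rw [← take_window x i hl, ← List.prefix_iff_eq_take.1 h]⟩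
  · rintro ⟨hl, h⟩
    rw [← h, ← take_window x i hl]
    simp [List.take_prefix]

theorem window_congr {x y : ℕ → A} {i j n : ℕ} (h : ∀ t < n, x (i + t) = y (j + t)) :
    window x i n = window y j n :=
  List.map_congr_left fun t ht => h t (List.mem_range.1 ht)

theorem window_eq_iff {x y : ℕ → A} {i j n : ℕ} :
    window x i n = window y j n ↔ ∀ t < n, x (i + t) = y (j + t) := by
  simp [window, List.map_inj_left]

/-- The words of length `n`, as a finite set. -/
def words (A : Type*) [Fintype A] [DecidableEq A] : ℕ → Finset (List A)
  | 0 => {[]}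
  | n + 1 => (words A n ×ˢ Finset.univ).image fun p => p.1 ++ [p.2]

variable [Fintype A] [DecidableEq A]

@[simp]
theorem mem_words {n : ℕ} {u : List A} : u ∈ words A n ↔ u.length = n := by
  induction n generalizing u with
  | zero => simp [words]
  | succ n ih =>
    rcases List.eq_nil_or_concat u with rfl | ⟨u, c, rfl⟩
    · simp [words]
    · simp [words, ih]

theorem sum_words_succ {R : Type*} [AddCommMonoid R] (n : ℕ) (F : List A → R) :
    ∑ u ∈ words A (n + 1), F u = ∑ u ∈ words A n, ∑ b, F (u ++ [b]) := by
  rw [words, Finset.sum_image, Finset.sum_product]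
  rintro ⟨u, a⟩ - ⟨v, b⟩ - h
  simpa using h

theorem sum_words_succ' {R : Type*} [AddCommMonoid R] (n : ℕ) (F : List A → R) :
    ∑ u ∈ words A (n + 1), F u = ∑ a, ∑ u ∈ words A n, F (a :: u) := by
  rw [← Finset.sum_product']
  symm
  refine Finset.sum_bij (fun p _ => p.1 :: p.2) (by simp) ?_ ?_ (by simp)
  · rintro ⟨a, u⟩ - ⟨b, v⟩ - h
    simpa using h
  · rintro (_ | ⟨a, u⟩) hu
    · simp at hu
    · exact ⟨(a, u), by simpa using hu, rfl⟩

/-- The word `u` is the label of a path of the graph with adjacency matrix `M`. -/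
def IsPath {A : Type*} (M : Matrix A A ℝ) (u : List A) : Prop :=
  u.IsChain fun a b => M a b = 1

theorem isPath_window {A : Type*} {M : Matrix A A ℝ} {x : ℕ → A} (hx : x ∈ sft M) (i n : ℕ) :
    IsPath M (window x i n) := by
  rw [IsPath, List.isChain_iff_getElem]
  intro t ht
  simpa [add_assoc] using hx (i + t)

open Classical in
/-- The paths with `n` vertices, as a finite set of words. -/
noncomputable def paths (M : Matrix A A ℝ) (n : ℕ) : Finset (List A) :=
  (words A n).filter (IsPath M)

theorem mem_paths {M : Matrix A A ℝ} {n : ℕ} {u : List A} :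
    u ∈ paths M n ↔ u.length = n ∧ IsPath M u := by
  simp [paths]

theorem window_mem_paths {M : Matrix A A ℝ} {x : ℕ → A} (hx : x ∈ sft M) (i n : ℕ) :
    window x i n ∈ paths M n :=
  mem_paths.2 ⟨length_window x i n, isPath_window hx i n⟩

end Words

/-! ### Path probabilities of the Parry measure -/

section PathProb

variable {A : Type*}

/-- The transition matrix of the Parry measure, for an eigenvalue `lam` and an eigenvector `r`. -/
noncomputable def parryMatrix (M : Matrix A A ℝ) (lam : ℝ) (r : A → ℝ) : Matrix A A ℝ :=
  fun a b => M a b * r b / (lam * r a)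

theorem pathProb_append (P : Matrix A A ℝ) (a : A) (u v : List A) :
    pathProb P a (u ++ v) = pathProb P a u * pathProb P (u.getLastD a) v := by
  induction u generalizing a with
  | nil => simp [pathProb]
  | cons b u ih => simp only [List.cons_append, pathProb, ih, List.getLastD_cons, mul_assoc]

theorem pathProb_concat (P : Matrix A A ℝ) (a b : A) (u : List A) :
    pathProb P a (u ++ [b]) = pathProb P a u * P (u.getLastD a) b := by
  simp [pathProb_append, pathProb]

theorem pathProb_nonneg {P : Matrix A A ℝ} (hP : ∀ a b, 0 ≤ P a b) (a : A) (u : List A) :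
    0 ≤ pathProb P a u := by
  induction u generalizing a with
  | nil => exact zero_le_one
  | cons b u ih => exact mul_nonneg (hP a b) (ih b)

theorem sum_pathProb [Fintype A] [DecidableEq A] {P : Matrix A A ℝ} (hP : ∀ a, ∑ b, P a b = 1)
    (a : A) (n : ℕ) : ∑ u ∈ words A n, pathProb P a u = 1 := by
  induction n with
  | zero => simp [words, pathProb]
  | succ n ih => simp_rw [sum_words_succ, pathProb_concat, ← Finset.mul_sum, hP, mul_one, ih]

theorem sum_pathProb_concat [Fintype A] [DecidableEq A] (P : Matrix A A ℝ) (a b : A) (n : ℕ) :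
    ∑ u ∈ words A n, pathProb P a (u ++ [b]) = (P ^ (n + 1)) a b := by
  induction n generalizing a with
  | zero => simp [words, pathProb]
  | succ n ih =>
    rw [pow_succ', Matrix.mul_apply, sum_words_succ']
    refine Finset.sum_congr rfl fun c _ => ?_
    rw [← ih c, Finset.mul_sum]
    rfl

/-- `r` is a positive right eigenvector of the `0`-`1` matrix `M` for the eigenvalue `lam > 1`. -/
structure IsPerron [Fintype A] (M : Matrix A A ℝ) (lam : ℝ) (r : A → ℝ) : Prop where
  zero_or_one : ∀ a b, M a b = 0 ∨ M a b = 1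
  one_lt : 1 < lam
  pos : ∀ a, 0 < r a
  eig : ∀ a, ∑ b, M a b * r b = lam * r a

namespace IsPerron

variable [Fintype A] {M : Matrix A A ℝ} {lam : ℝ} {r : A → ℝ}

theorem lam_pos (h : IsPerron M lam r) : 0 < lam := zero_lt_one.trans h.one_lt

theorem parryMatrix_nonneg (h : IsPerron M lam r) (a b : A) : 0 ≤ parryMatrix M lam r a b := by
  have h1 : 0 ≤ M a b := by rcases h.zero_or_one a b with h | h <;> simp [h]
  exact div_nonneg (mul_nonneg h1 (h.pos b).le) (mul_pos h.lam_pos (h.pos a)).le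

theorem sum_parryMatrix (h : IsPerron M lam r) (a : A) : ∑ b, parryMatrix M lam r a b = 1 := by
  simp only [parryMatrix, ← Finset.sum_div, h.eig]
  exact div_self (mul_pos h.lam_pos (h.pos a)).ne'

theorem parryMatrix_le_one (h : IsPerron M lam r) (a b : A) : parryMatrix M lam r a b ≤ 1 :=
  h.sum_parryMatrix a ▸
    Finset.single_le_sum (fun c _ => h.parryMatrix_nonneg a c) (Finset.mem_univ b)

theorem parryMatrix_pow_apply [DecidableEq A] (h : IsPerron M lam r) (k : ℕ) (a b : A) :
    (parryMatrix M lam r ^ k) a b = (M ^ k) a b * r b / (lam ^ k * r a) := by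
  have hl := h.lam_pos.ne'
  induction k generalizing b with
  | zero =>
    rcases eq_or_ne a b with rfl | hab
    · simp [(h.pos a).ne']
    · simp [hab]
  | succ k ih =>
    rw [pow_succ, pow_succ, Matrix.mul_apply, Matrix.mul_apply, Finset.sum_mul, Finset.sum_div]
    refine Finset.sum_congr rfl fun c _ => ?_
    have hc := (h.pos c).ne'
    have ha := (h.pos a).ne'
    rw [ih, parryMatrix]
    field_simp
    ring

theorem pathProb_of_isPath (h : IsPerron M lam r) {a : A} {u : List A} (hu : IsPath M (a :: u)) :
    pathProb (parryMatrix M lam r) a u = r (u.getLastD a) / (lam ^ u.length * r a) := by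
  have hl := h.lam_pos.ne'
  induction u generalizing a with
  | nil => simp [pathProb, (h.pos a).ne']
  | cons b u ih =>
    have hb := (h.pos b).ne'
    have ha := (h.pos a).ne'
    rw [IsPath, List.isChain_cons_cons] at hu
    rw [pathProb, ih hu.2, parryMatrix, hu.1, List.getLastD_cons, List.length_cons, pow_succ]
    field_simp

theorem pathProb_of_not_isPath (h : IsPerron M lam r) {a : A} {u : List A}
    (hu : ¬ IsPath M (a :: u)) : pathProb (parryMatrix M lam r) a u = 0 := by
  induction u generalizing a with
  | nil => exact absurd (List.isChain_singleton a) hu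
  | cons b u ih =>
    rw [IsPath, List.isChain_cons_cons, not_and_or] at hu
    rw [pathProb]
    rcases hu with hu | hu
    · simp [parryMatrix, (h.zero_or_one a b).resolve_right hu]
    · rw [ih hu, mul_zero]

theorem exists_ratio_bound (h : IsPerron M lam r) : ∃ c > 0, ∀ a b, c * r a ≤ r b := by
  rcases isEmpty_or_nonempty A with hA | hA
  · exact ⟨1, one_pos, fun a => hA.elim a⟩
  obtain ⟨p, -, hp⟩ := Finset.exists_min_image (Finset.univ : Finset (A × A))
    (fun p => r p.2 / r p.1) Finset.univ_nonempty
  refine ⟨r p.2 / r p.1, div_pos (h.pos _) (h.pos _), fun a b => ?_⟩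
  exact (le_div_iff₀ (h.pos a)).1 (hp (a, b) (Finset.mem_univ _))

/-- Along a path, the path probability is `lam ^ (-length)`, up to a constant factor. -/
theorem exists_pathProb_bounds (h : IsPerron M lam r) :
    ∃ c > 0, ∀ a u, pathProb (parryMatrix M lam r) a u ≤ 1 / (c * lam ^ u.length) ∧
      (IsPath M (a :: u) → c / lam ^ u.length ≤ pathProb (parryMatrix M lam r) a u) := by
  obtain ⟨c, hc, hcr⟩ := h.exists_ratio_bound
  refine ⟨c, hc, fun a u => ?_⟩
  have hpos := pow_pos h.lam_pos u.length
  by_cases hu : IsPath M (a :: u)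
  · rw [h.pathProb_of_isPath hu]
    refine ⟨?_, fun _ => ?_⟩
    · rw [div_le_div_iff₀ (mul_pos hpos (h.pos a)) (mul_pos hc hpos)]
      nlinarith [hcr (u.getLastD a) a]
    · rw [div_le_div_iff₀ hpos (mul_pos hpos (h.pos a))]
      nlinarith [hcr a (u.getLastD a)]
  · rw [h.pathProb_of_not_isPath hu]
    exact ⟨by positivity, fun h => absurd h hu⟩

end IsPerron

end PathProb

/-! ### Branching, and the Perron eigenvalue -/

section Branching

variable {A : Type*} {M : Matrix A A ℝ}

/-- If no row of `M` has two entries `1`, then the points of `X_M` are determined by their first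
letters. -/
theorem exists_two_successors_of_infinite [Finite A] (h : (sft M).Infinite) :
    ∃ a b b', b ≠ b' ∧ M a b = 1 ∧ M a b' = 1 := by
  by_contra! hcon
  refine h (Set.Finite.of_injOn (f := fun x : ℕ → A => x 0) (t := Set.univ) (fun _ _ => trivial) ?_
    Set.finite_univ)
  intro x hx y hy hxy
  funext n
  induction n with
  | zero => exact hxy
  | succ n ih =>
    by_contra hne
    exact hcon (x n) _ _ hne (hx n) (ih ▸ hy n)

/-- If no row of `M` has two entries `1`, then no row of a power of `M` has two positive entries. -/
theorem exists_two_successors_of_isPrimitive [Fintype A] [DecidableEq A] [Nontrivial A]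
    (hM : ∀ a b, M a b = 0 ∨ M a b = 1) (h : M.IsPrimitive) :
    ∃ a b b', b ≠ b' ∧ M a b = 1 ∧ M a b' = 1 := by
  by_contra! hcon
  have hnonneg := h.nonneg
  obtain ⟨k, -, hk⟩ := h.exists_pos_pow
  have key : ∀ k a b b', 0 < (M ^ k) a b → 0 < (M ^ k) a b' → b = b' := by
    intro k
    induction k with
    | zero =>
      intro a b b' h1 h2
      rw [pow_zero, Matrix.one_apply] at h1 h2
      split_ifs at h1 h2 with e1 e2
      · exact e1.symm.trans e2
      all_goals simp_all
    | succ k ih =>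
      intro a b b' h1 h2
      rw [pow_succ, Matrix.mul_apply] at h1 h2
      obtain ⟨c, -, hc⟩ := Finset.exists_lt_of_sum_lt (by simpa using h1 :
        ∑ _c : A, (0 : ℝ) < _)
      obtain ⟨c', -, hc'⟩ := Finset.exists_lt_of_sum_lt (by simpa using h2 :
        ∑ _c : A, (0 : ℝ) < _)
      have p1 := pos_of_mul_pos_left hc (hnonneg c b)
      have p2 := pos_of_mul_pos_left hc' (hnonneg c' b')
      obtain rfl := ih a c c' p1 p2
      have q1 : M c b = 1 := (hM c b).resolve_left fun h0 => by simp [h0] at hc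
      have q2 : M c b' = 1 := (hM c b').resolve_left fun h0 => by simp [h0] at hc'
      by_contra hne
      exact hcon c b b' hne q1 q2
  obtain ⟨a, b, hab⟩ := exists_pair_ne A
  exact hab (key k a a b (hk a a) (hk a b))

variable [Fintype A] [DecidableEq A] [Nontrivial A]

/-- Every row sum is at least `1` and some row sum is at least `2`; weighting the rows by a positive
left eigenvector gives `lam > 1`. -/
theorem one_lt_of_two_successors (hM : ∀ a b, M a b = 0 ∨ M a b = 1) (hirr : M.IsIrreducible)
    (hbr : ∃ a b b', b ≠ b' ∧ M a b = 1 ∧ M a b' = 1) {lam : ℝ} {l : A → ℝ} (hl : ∀ a, 0 < l a)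
    (hlM : ∀ b, ∑ a, l a * M a b = lam * l b) : 1 < lam := by
  obtain ⟨a, b, b', hne, hb, hb'⟩ := hbr
  have hrow : ∀ a, 1 ≤ ∑ b, M a b := by
    intro a
    obtain ⟨b, hb⟩ := hirr.exists_pos a
    have hb1 : M a b = 1 := (hM a b).resolve_left hb.ne'
    exact hb1 ▸ Finset.single_le_sum (fun c _ => hirr.nonneg a c) (Finset.mem_univ b)
  have hrow2 : 1 < ∑ b, M a b := by
    have : ∑ c ∈ {b, b'}, M a c ≤ ∑ c, M a c :=
      Finset.sum_le_sum_of_subset_of_nonneg (Finset.subset_univ _) fun c _ _ => hirr.nonneg a c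
    rw [Finset.sum_pair hne, hb, hb'] at this
    linarith
  have hs : 0 < ∑ a, l a := Finset.sum_pos (fun a _ => hl a) Finset.univ_nonempty
  have h1 : lam * ∑ a, l a = ∑ a, l a * ∑ b, M a b := by
    simp_rw [Finset.mul_sum, ← hlM]
    exact Finset.sum_comm
  have h2 : ∑ a, l a < ∑ a, l a * ∑ b, M a b := by
    refine Finset.sum_lt_sum (fun c _ => ?_) ⟨a, Finset.mem_univ a, ?_⟩
    · exact le_mul_of_one_le_right (hl c).le (hrow c)
    · exact lt_mul_of_one_lt_right (hl a) hrow2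
  rw [← h1] at h2
  by_contra! hlam
  nlinarith

theorem IsParryMeasure.exists_isPerron (hM : ∀ a b, M a b = 0 ∨ M a b = 1) (hirr : M.IsIrreducible)
    (hbr : ∃ a b b', b ≠ b' ∧ M a b = 1 ∧ M a b' = 1) {μ : List A → ℝ} (hμ : IsParryMeasure M μ) :
    ∃ (lam : ℝ) (l r : A → ℝ), IsPerron M lam r ∧ (∀ a, 0 < l a) ∧
      (∀ b, ∑ a, l a * M a b = lam * l b) ∧ ∑ a, l a * r a = 1 ∧
      μ = markovMeasure (fun a => l a * r a) (parryMatrix M lam r) := by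
  obtain ⟨lam, l, r, -, hl, hr, hMr, hlM, hs, rfl⟩ := hμ
  exact ⟨lam, l, r, ⟨hM, one_lt_of_two_successors hM hirr hbr hl hlM, hr, hMr⟩, hl, hlM, hs, rfl⟩

end Branching

/-! ### Numbers of paths -/

section Counting

variable {A : Type*} [Fintype A] [DecidableEq A] {M : Matrix A A ℝ} {lam : ℝ} {r : A → ℝ}

theorem sum_paths_succ (n : ℕ) (F : List A → ℝ) [∀ u, Decidable (IsPath M u)] :
    ∑ v ∈ paths M (n + 1), F v =
      ∑ a, ∑ u ∈ words A n, if IsPath M (a :: u) then F (a :: u) else 0 := by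
  classical
  rw [paths, Finset.sum_filter, sum_words_succ']
  congr! 5

namespace IsPerron

/-- A sum over paths is, up to a constant factor, at most the corresponding expectation multiplied
by the number of paths. -/
theorem exists_sum_paths_le (h : IsPerron M lam r) :
    ∃ c > 0, ∀ (n : ℕ) (F : List A → ℝ), (∀ u, 0 ≤ F u) →
      c * ∑ v ∈ paths M (n + 1), F v ≤
        lam ^ n * ∑ a, ∑ u ∈ words A n, pathProb (parryMatrix M lam r) a u * F (a :: u) := by
  classical
  obtain ⟨c, hc, hb⟩ := h.exists_pathProb_bounds
  refine ⟨c, hc, fun n F hF => ?_⟩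
  rw [sum_paths_succ, Finset.mul_sum, Finset.mul_sum]
  refine Finset.sum_le_sum fun a _ => ?_
  rw [Finset.mul_sum, Finset.mul_sum]
  refine Finset.sum_le_sum fun u hu => ?_
  have hpos := pow_pos h.lam_pos n
  split_ifs with hp
  · have h1 := (hb a u).2 hp
    rw [mem_words.1 hu, div_le_iff₀ hpos] at h1
    calc c * F (a :: u) ≤ _ := mul_le_mul_of_nonneg_right h1 (hF _)
      _ = _ := by ring
  · rw [mul_zero]
    exact mul_nonneg hpos.le (mul_nonneg (pathProb_nonneg h.parryMatrix_nonneg a u) (hF _))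

theorem exists_card_paths_le (h : IsPerron M lam r) :
    ∃ C > 0, ∀ n, ((paths M n).card : ℝ) ≤ C * lam ^ n := by
  classical
  obtain ⟨c, hc, hF⟩ := h.exists_sum_paths_le
  refine ⟨1 + Fintype.card A / c, by positivity, fun n => ?_⟩
  have hl := h.lam_pos
  rcases n with _ | n
  · have : ((paths M 0).card : ℝ) ≤ 1 := by
      exact_mod_cast (Finset.card_filter_le _ _).trans (by simp [words])
    have h2 : 0 ≤ (Fintype.card A : ℝ) / c := by positivity
    rw [pow_zero, mul_one]
    linarith
  · have h1 := hF n (fun _ => 1) fun _ => zero_le_one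
    simp only [mul_one, sum_pathProb h.sum_parryMatrix, Finset.sum_const, nsmul_eq_mul,
      Finset.card_univ] at h1
    have h2 : ((paths M (n + 1)).card : ℝ) ≤ Fintype.card A / c * lam ^ n := by
      rw [div_mul_eq_mul_div, le_div_iff₀ hc]
      linarith
    have h3 : lam ^ n ≤ lam ^ (n + 1) := pow_le_pow_right₀ h.one_lt.le (Nat.le_succ n)
    calc _ ≤ _ := h2
      _ ≤ (1 + Fintype.card A / c) * lam ^ (n + 1) := by gcongr; linarith

theorem exists_le_card_paths [Nonempty A] (h : IsPerron M lam r) :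
    ∃ c > 0, ∀ n, c * lam ^ n ≤ (paths M (n + 1)).card := by
  classical
  obtain ⟨c, hc, hb⟩ := h.exists_pathProb_bounds
  refine ⟨c, hc, fun n => ?_⟩
  obtain ⟨a⟩ : Nonempty A := inferInstance
  have hpos := pow_pos h.lam_pos n
  have h1 : ((paths M (n + 1)).card : ℝ) = ∑ v ∈ paths M (n + 1), 1 := by simp
  rw [h1, sum_paths_succ]
  have h2 : ∑ u ∈ words A n, (if IsPath M (a :: u) then (1 : ℝ) else 0) ≤
      ∑ a, ∑ u ∈ words A n, if IsPath M (a :: u) then (1 : ℝ) else 0 :=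
    Finset.single_le_sum (f := fun a => ∑ u ∈ words A n, if IsPath M (a :: u) then (1 : ℝ) else 0)
      (fun b _ => Finset.sum_nonneg fun u _ => by split_ifs <;> norm_num) (Finset.mem_univ a)
  refine le_trans ?_ h2
  have h4 := sum_pathProb h.sum_parryMatrix a n
  rw [← mul_one (c * lam ^ n), ← h4, Finset.mul_sum]
  refine Finset.sum_le_sum fun u hu => ?_
  split_ifs with hp
  · have h3 := (hb a u).1
    rw [mem_words.1 hu, le_div_iff₀ (mul_pos hc hpos)] at h3
    linarith
  · rw [h.pathProb_of_not_isPath hp, mul_zero]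

end IsPerron

/-- The additive functional `∑ t, D (u₀ ⋯ uₜ₋₁) uₜ` of a word `u`. -/
noncomputable def pathSum {A : Type*} (D : List A → A → ℝ) (u : List A) : ℝ :=
  ∑ t ∈ Finset.range u.length, (u[t]?).elim 0 (D (u.take t))

theorem pathSum_concat {A : Type*} (D : List A → A → ℝ) (u : List A) (c : A) :
    pathSum D (u ++ [c]) = pathSum D u + D u c := by
  rw [pathSum, List.length_append, List.length_singleton, Finset.sum_range_succ]
  congr 1
  · refine Finset.sum_congr rfl fun t ht => ?_
    have ht' := Finset.mem_range.1 ht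
    rw [List.getElem?_append_left ht', List.take_append_of_le_length ht'.le]
  · simp

theorem pathSum_window {A : Type*} (D : List A → A → ℝ) (x : ℕ → A) (i n : ℕ) :
    pathSum D (window x i n) = ∑ t ∈ Finset.range n, D (window x i t) (x (i + t)) := by
  induction n with
  | zero => simp [pathSum]
  | succ n ih => rw [window_succ, pathSum_concat, ih, Finset.sum_range_succ]

/-- If the increments of the additive functional are bounded by `1` and have conditional
expectation `0`, then they are orthogonal, so the second moment grows at most linearly. -/
theorem sum_pathProb_mul_pathSum_sq_le {P : Matrix A A ℝ} (hP0 : ∀ a b, 0 ≤ P a b)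
    (hP1 : ∀ a, ∑ b, P a b = 1) {D : List A → A → ℝ} (hD : ∀ u c, |D u c| ≤ 1)
    (hmart : ∀ a u, ∑ c, P (u.getLastD a) c * D (a :: u) c = 0) (a : A) (n : ℕ) :
    ∑ u ∈ words A n, pathProb P a u * pathSum D (a :: u) ^ 2 ≤ n + 1 := by
  have hD2 : ∀ u c, D u c ^ 2 ≤ 1 := fun u c => (sq_le_one_iff_abs_le_one _).2 (hD u c)
  induction n with
  | zero => simpa [words, pathProb, pathSum] using hD2 [] a
  | succ n ih =>
    rw [sum_words_succ]
    have key : ∀ u ∈ words A n, ∑ c, pathProb P a (u ++ [c]) * pathSum D (a :: (u ++ [c])) ^ 2 ≤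
        pathProb P a u * pathSum D (a :: u) ^ 2 + pathProb P a u := by
      intro u _
      have hp := pathProb_nonneg hP0 a u
      calc ∑ c, pathProb P a (u ++ [c]) * pathSum D (a :: (u ++ [c])) ^ 2
          = pathProb P a u * ∑ c, (P (u.getLastD a) c * pathSum D (a :: u) ^ 2 +
              2 * pathSum D (a :: u) * (P (u.getLastD a) c * D (a :: u) c) +
              P (u.getLastD a) c * D (a :: u) c ^ 2) := by
            rw [Finset.mul_sum]
            refine Finset.sum_congr rfl fun c _ => ?_
            rw [pathProb_concat, ← List.cons_append, pathSum_concat]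
            ring
        _ = pathProb P a u * (pathSum D (a :: u) ^ 2 +
              ∑ c, P (u.getLastD a) c * D (a :: u) c ^ 2) := by
            rw [Finset.sum_add_distrib, Finset.sum_add_distrib, ← Finset.sum_mul, hP1,
              ← Finset.mul_sum, hmart]
            ring
        _ ≤ pathProb P a u * (pathSum D (a :: u) ^ 2 + 1) := by
            gcongr
            rw [← hP1 (u.getLastD a)]
            exact Finset.sum_le_sum fun c _ => mul_le_of_le_one_right (hP0 _ _) (hD2 _ _)
        _ = _ := by ring
    calc _ ≤ _ := Finset.sum_le_sum key
      _ ≤ (n + 1) + 1 := by rw [Finset.sum_add_distrib, sum_pathProb hP1]; gcongr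
      _ = _ := by push_cast; ring

open Classical in
/-- Chebyshev's inequality for the number of paths on which the additive functional is large. -/
theorem IsPerron.exists_card_large_pathSum_le (h : IsPerron M lam r) :
    ∃ C > 0, ∀ D : List A → A → ℝ, (∀ u c, |D u c| ≤ 1) →
      (∀ a u, ∑ c, parryMatrix M lam r (u.getLastD a) c * D (a :: u) c = 0) →
      ∀ (n : ℕ) (θ : ℝ), 0 < θ →
        (((paths M n).filter fun u => θ ≤ |pathSum D u|).card : ℝ) ≤ C * n * lam ^ n / θ ^ 2 := by
  obtain ⟨c, hc, hF⟩ := h.exists_sum_paths_le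
  refine ⟨(Fintype.card A + 1) / c, by positivity, fun D hD hmart n θ hθ => ?_⟩
  rcases n with _ | n
  · have : (paths M 0).filter (fun u => θ ≤ |pathSum D u|) = ∅ := by
      refine Finset.filter_eq_empty_iff.2 fun u hu => ?_
      rw [List.length_eq_zero_iff.1 (mem_paths.1 hu).1]
      simpa [pathSum] using hθ
    simp [this]
  have hpos := pow_pos h.lam_pos n
  have h1 : θ ^ 2 * ((paths M (n + 1)).filter fun u => θ ≤ |pathSum D u|).card ≤
      ∑ v ∈ paths M (n + 1), pathSum D v ^ 2 := by
    rw [mul_comm, ← nsmul_eq_mul, ← Finset.sum_const, Finset.sum_filter]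
    refine Finset.sum_le_sum fun v _ => ?_
    split_ifs with hv
    · rw [← sq_abs (pathSum D v)]
      gcongr
    · positivity
  have h2 := hF n (fun v => pathSum D v ^ 2) fun _ => sq_nonneg _
  have h3 : ∑ a, ∑ u ∈ words A n, pathProb (parryMatrix M lam r) a u * pathSum D (a :: u) ^ 2 ≤
      (Fintype.card A + 1) * (n + 1) := by
    calc _ ≤ ∑ _a : A, ((n : ℝ) + 1) := Finset.sum_le_sum fun a _ =>
          sum_pathProb_mul_pathSum_sq_le h.parryMatrix_nonneg h.sum_parryMatrix hD hmart a n
      _ = Fintype.card A * (n + 1) := by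
          rw [Finset.sum_const, nsmul_eq_mul, Finset.card_univ]
      _ ≤ _ := by gcongr; linarith
  have h4 : lam ^ n ≤ lam ^ (n + 1) := pow_le_pow_right₀ h.one_lt.le (Nat.le_succ n)
  rw [le_div_iff₀ (by positivity), div_mul_eq_mul_div, div_mul_eq_mul_div, le_div_iff₀ hc]
  calc _ = c * (θ ^ 2 * ((paths M (n + 1)).filter fun u => θ ≤ |pathSum D u|).card) := by ring
    _ ≤ c * ∑ v ∈ paths M (n + 1), pathSum D v ^ 2 := by gcongr
    _ ≤ _ := h2
    _ ≤ lam ^ n * ((Fintype.card A + 1) * (n + 1)) := by gcongr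
    _ ≤ lam ^ (n + 1) * ((Fintype.card A + 1) * (n + 1)) := by gcongr
    _ = _ := by push_cast; ring

end Counting

/-! ### Concatenations and runs -/

section Concat

variable {B : Type*}

theorem concatPrefix_eq_window (v : ℕ → List B) (n : ℕ) :
    concatPrefix v n = (window v 0 n).flatten := by
  simp [concatPrefix, window]

theorem concatPrefix_add (v : ℕ → List B) (m n : ℕ) :
    concatPrefix v (m + n) = concatPrefix v m ++ (window v m n).flatten := by
  simp [concatPrefix_eq_window, window_add]

theorem concatPrefix_succ (v : ℕ → List B) (n : ℕ) :
    concatPrefix v (n + 1) = concatPrefix v n ++ v n := by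
  simp [concatPrefix_add, window]

theorem concatPrefix_prefix (v : ℕ → List B) {m n : ℕ} (h : m ≤ n) :
    concatPrefix v m <+: concatPrefix v n := by
  obtain ⟨k, rfl⟩ := Nat.exists_eq_add_of_le h
  exact ⟨_, (concatPrefix_add v m k).symm⟩

theorem length_concatPrefix (v : ℕ → List B) (n : ℕ) :
    (concatPrefix v n).length = ∑ i ∈ Finset.range n, (v i).length := by
  induction n with
  | zero => simp [concatPrefix]
  | succ n ih => rw [concatPrefix_succ, List.length_append, ih, Finset.sum_range_succ]

theorem eq_seqPrefix_of_prefix {y : ℕ → B} {u : List B} {n : ℕ} (h : u <+: seqPrefix y n) :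
    u = seqPrefix y u.length := by
  rw [seqPrefix_eq_window] at h ⊢
  exact ((prefix_window_iff y 0 n u).1 h).2.symm

/-- It suffices to compare the concatenation with the sequence on infinitely many prefixes. -/
theorem isConcat_of_frequently {v : ℕ → List B} {y : ℕ → B}
    (hlim : Tendsto (fun n => (concatPrefix v n).length) atTop atTop)
    (h : ∃ᶠ n in atTop, concatPrefix v n = seqPrefix y (concatPrefix v n).length) :
    IsConcat v y := by
  refine ⟨hlim, fun n => ?_⟩
  obtain ⟨m, hm, he⟩ := (frequently_atTop.1 h) n
  exact eq_seqPrefix_of_prefix (he ▸ concatPrefix_prefix v hm)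

theorem IsConcat.isPath_flatten_window {M : Matrix B B ℝ} {v : ℕ → List B} {y : ℕ → B}
    (h : IsConcat v y) (hy : y ∈ sft M) (t n : ℕ) : IsPath M (window v t n).flatten := by
  have h1 : IsPath M (concatPrefix v (t + n)) := by
    rw [h.2, seqPrefix_eq_window]
    exact isPath_window hy _ _
  rw [concatPrefix_add] at h1
  exact h1.right_of_append

end Concat

/-! ### Splicing runs -/

section Splice

/-- The sequence `f` with its values on `[t, t + n)` replaced by those on `[t', t' + n)`. -/
def splice {B : Type*} (t t' n : ℕ) (f : ℕ → B) (i : ℕ) : B :=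
  if t ≤ i ∧ i < t + n then f (t' + (i - t)) else f i

variable {B : Type*} {t t' n : ℕ} {f : ℕ → B}

theorem splice_inside {i : ℕ} (h : f (t + n) = f (t' + n)) (h1 : t ≤ i) (h2 : i ≤ t + n) :
    splice t t' n f i = f (t' + (i - t)) := by
  rw [splice]
  split_ifs with hi
  · rfl
  · obtain rfl : i = t + n := by lia
    rw [h, Nat.add_sub_cancel_left]

theorem splice_outside {i : ℕ} (h : f t = f t') (h1 : i ≤ t ∨ t + n ≤ i) :
    splice t t' n f i = f i := by
  rw [splice]
  split_ifs with hi
  · obtain rfl : i = t := by lia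
    rw [h, Nat.sub_self, Nat.add_zero]
  · rfl

theorem window_splice : window (splice t t' n f) t n = window f t' n := by
  refine window_congr fun i hi => ?_
  rw [splice, if_pos (by lia), Nat.add_sub_cancel_left]

theorem window_splice_left : window (splice t t' n f) 0 t = window f 0 t := by
  refine window_congr fun i hi => ?_
  rw [splice, if_neg (by lia)]

theorem window_splice_right (m : ℕ) :
    window (splice t t' n f) (t + n) m = window f (t + n) m := by
  refine window_congr fun i hi => ?_
  rw [splice, if_neg (by lia)]

/-- Replacing a factor of a run by a factor with the same end states, the same letters at its two
ends, and the same output gives another run with the same output, whose input label is still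
in `X_M`. -/
theorem realizes_splice {Q A : Type*} {M : Matrix A A ℝ} {T : Transducer Q A A} {x : ℕ → A}
    {q : ℕ → Q} {v : ℕ → List A} {y : ℕ → A} (hx : x ∈ sft M) (hrun : T.IsAcceptingRun q x v)
    (hy : IsConcat v y) (hq : q t = q t') (hxt : x t = x t') (hq' : q (t + n) = q (t' + n))
    (hxt' : x (t + n) = x (t' + n)) (hv : (window v t n).flatten = (window v t' n).flatten) :
    splice t t' n x ∈ sft M ∧ T.Realizes (splice t t' n x) y := by
  refine ⟨fun i => ?_, splice t t' n q, splice t t' n v, ⟨?_, fun i => ?_, ?_⟩, ?_⟩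
  · by_cases hi : t ≤ i ∧ i < t + n
    · rw [splice_inside hxt' hi.1 hi.2.le, splice_inside hxt' (by lia) hi.2,
        show t' + (i + 1 - t) = t' + (i - t) + 1 by lia]
      exact hx _
    · rw [splice_outside hxt (by lia), splice_outside hxt (by lia)]
      exact hx _
  · rw [splice_outside hq (by lia)]
    exact hrun.1
  · by_cases hi : t ≤ i ∧ i < t + n
    · rw [splice_inside hq' hi.1 hi.2.le, splice_inside hq' (by lia) hi.2,
        show t' + (i + 1 - t) = t' + (i - t) + 1 by lia, splice, if_pos hi, splice, if_pos hi]
      exact hrun.2.1 _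
    · rw [splice_outside hq (by lia), splice_outside hq (by lia), splice, if_neg hi, splice,
        if_neg hi]
      exact hrun.2.1 _
  · refine (hrun.2.2.and_eventually (eventually_ge_atTop (t + n))).mono fun i hi => ?_
    rw [splice_outside hq (Or.inr hi.2)]
    exact hi.1
  · have key : ∀ i ≥ t + n, concatPrefix (splice t t' n v) i = concatPrefix v i := by
      intro i hi
      obtain ⟨k, rfl⟩ := Nat.exists_eq_add_of_le hi
      rw [concatPrefix_add, concatPrefix_add, concatPrefix_add, concatPrefix_add,
        concatPrefix_eq_window, concatPrefix_eq_window, window_splice, window_splice_left,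
        window_splice_right, hv]
    have key' := (eventually_ge_atTop (t + n)).mono key
    refine isConcat_of_frequently (hy.1.congr' (key'.mono fun i hi => by simp only [hi])) ?_
    exact (key'.mono fun i hi => by rw [hi]; exact hy.2 i).frequently

end Splice

/-! ### Normal sequences are incompressible -/

section Incompressible

variable {A : Type*} [Fintype A] [DecidableEq A] {M : Matrix A A ℝ} {lam : ℝ} {r : A → ℝ}

/-- In a run of a bounded-to-one transducer, the factors of the input of length `N` that are
compressed to length at most `L` are at most as many as the paths of length at most `L`, up to a
constant factor: factors with the same output, the same end states and the same end letters can be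
spliced into one position of the run. -/
theorem exists_card_compressed_factors_le {Q : Type*} [Finite Q] {T : Transducer Q A A} {x : ℕ → A}
    (hfun : T.ComputesFunction (sft M) (sft M)) (hbdd : T.IsBoundedToOne (sft M)) (hx : x ∈ sft M)
    {q : ℕ → Q} {v : ℕ → List A} (hrun : T.IsAcceptingRun q x v) :
    ∃ K : ℕ, ∀ (N L : ℕ) (B : Finset (List A)),
      (∀ u ∈ B, ∃ t, window x t N = u ∧ (window v t N).flatten.length ≤ L) →
      B.card ≤ K * ∑ m ∈ Finset.range (L + 1), (paths M m).card := by
  classical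
  have := Fintype.ofFinite Q
  obtain ⟨y, hyM, hy⟩ := hfun.2 x hx q v hrun
  obtain ⟨K, hK⟩ := hbdd
  refine ⟨K * Fintype.card ((Q × A) × (Q × A)), fun N L B hB => ?_⟩
  choose! τ hτ hτL using hB
  let κ : List A → ((Q × A) × (Q × A)) × List A := fun u =>
    (((q (τ u), x (τ u)), (q (τ u + N), x (τ u + N))), (window v (τ u) N).flatten)
  have himage : (B.image κ).card ≤
      Fintype.card ((Q × A) × (Q × A)) * ∑ m ∈ Finset.range (L + 1), (paths M m).card := by
    refine (Finset.card_le_card (t := Finset.univ ×ˢ (Finset.range (L + 1)).biUnion (paths M))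
      ?_).trans ?_
    · intro k hk
      obtain ⟨u, hu, rfl⟩ := Finset.mem_image.1 hk
      simp only [κ, Finset.mem_product, Finset.mem_univ, true_and, Finset.mem_biUnion,
        Finset.mem_range, Nat.lt_succ_iff]
      exact ⟨_, hτL u hu, mem_paths.2 ⟨rfl, hy.isPath_flatten_window hyM _ _⟩⟩
    · rw [Finset.card_product, Finset.card_univ]
      exact Nat.mul_le_mul_left _ Finset.card_biUnion_le
  have hfiber : ∀ k ∈ B.image κ, (B.filter fun u => κ u = k).card ≤ K := by
    intro k hk
    obtain ⟨u₀, hu₀, rfl⟩ := Finset.mem_image.1 hk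
    let f : List A → ℕ → A := fun u => splice (τ u₀) (τ u) N x
    have hinj : Set.InjOn f (B.filter fun u => κ u = κ u₀) := by
      intro u hu u' hu' hf
      rw [Finset.mem_coe, Finset.mem_filter] at hu hu'
      rw [← hτ u hu.1, ← hτ u' hu'.1, ← window_splice (t := τ u₀) (f := x),
        ← window_splice (t := τ u₀) (t' := τ u') (f := x)]
      exact congrArg (fun z => window z (τ u₀) N) hf
    have hsub : (((B.filter fun u => κ u = κ u₀).image f : Finset (ℕ → A)) : Set (ℕ → A)) ⊆
        {z | z ∈ sft M ∧ T.Realizes z y} := by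
      intro z hz
      obtain ⟨u, hu, rfl⟩ := Finset.mem_image.1 (Finset.mem_coe.1 hz)
      have hk := (Finset.mem_filter.1 hu).2
      simp only [κ, Prod.mk.injEq] at hk
      obtain ⟨⟨⟨h1, h2⟩, h3, h4⟩, h5⟩ := hk
      exact realizes_splice hx hrun hy h1.symm h2.symm h3.symm h4.symm h5.symm
    have := (Set.encard_le_encard hsub).trans (hK y)
    rw [Set.encard_coe_eq_coe_finsetCard, Finset.card_image_of_injOn hinj] at this
    exact_mod_cast this
  calc B.card ≤ K * (B.image κ).card := Finset.card_le_mul_card_image B K hfiber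
    _ ≤ K * (Fintype.card ((Q × A) × (Q × A)) *
          ∑ m ∈ Finset.range (L + 1), (paths M m).card) := Nat.mul_le_mul_left _ himage
    _ = _ := (mul_assoc _ _ _).symm

/-- Summing the output lengths of overlapping windows counts each transition at most `k` times. -/
theorem sum_length_window_le {B : Type*} (v : ℕ → List B) (s k n : ℕ) :
    ∑ j ∈ Finset.range n, (window v (j * s) (s * k)).flatten.length ≤
      k * (concatPrefix v (s * (n + k))).length := by
  set o : ℕ → ℕ := fun j => (window v (j * s) s).flatten.length with ho
  have h1 : ∀ m j, (window v (j * s) (s * m)).flatten.length = ∑ e ∈ Finset.range m, o (e + j) := by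
    intro m j
    induction m with
    | zero => simp
    | succ m ih =>
      rw [mul_add, mul_one, window_add, List.flatten_append, List.length_append, ih,
        Finset.sum_range_succ, ho]
      congr 3
      ring_nf
  have h2 : ∀ m, (concatPrefix v (s * m)).length = ∑ e ∈ Finset.range m, o e := by
    intro m
    have := h1 m 0
    rw [zero_mul, ← concatPrefix_eq_window] at this
    simpa using this
  simp_rw [h1 k]
  rw [Finset.sum_comm, h2, ← smul_eq_mul]
  refine (Finset.sum_le_card_nsmul _ _ _ fun e he => ?_).trans (by rw [Finset.card_range])
  rw [← Finset.sum_image (f := o) (s := Finset.range n) (g := fun j => e + j)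
    fun _ _ _ _ h => Nat.add_left_cancel h]
  refine Finset.sum_le_sum_of_subset fun i hi => ?_
  obtain ⟨j, hj, rfl⟩ := Finset.mem_image.1 hi
  simp only [Finset.mem_range] at hj he ⊢
  lia

theorem Transducer.exists_length_le {Q A B : Type*} {T : Transducer Q A B} {q : ℕ → Q} {x : ℕ → A}
    {v : ℕ → List B} (hrun : T.IsAcceptingRun q x v) :
    ∃ C : ℕ, ∀ n, (concatPrefix v n).length ≤ C * n := by
  obtain ⟨C, hC⟩ := (T.finite_trans.image fun e => e.2.2.1.length).bddAbove
  refine ⟨C, fun n => ?_⟩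
  rw [length_concatPrefix]
  refine (Finset.sum_le_card_nsmul _ _ C fun i _ => ?_).trans
    (by rw [Finset.card_range, smul_eq_mul, mul_comm])
  exact hC ⟨_, hrun.2.1 i, rfl⟩

/-- If the frequencies of the words of each length `N`, counted at the multiples of some divisor
of `N`, are exponentially small at the rate `lam`, then the sequence is incompressible: the windows
whose output is short belong to a set of few words, hence they are rare. -/
theorem IsPerron.isIncompressible (h : IsPerron M lam r) {x : ℕ → A} (hx : x ∈ sft M)
    {μ : List A → ℝ} {C : ℝ} (hC : 0 < C)
    (hμ : ∀ u, u ≠ [] → μ u ≤ C / lam ^ u.length)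
    (hfreq : ∀ N ≥ 1, ∃ s k, 1 ≤ s ∧ N = s * k ∧ ∀ u, u.length = N →
      Tendsto (fun n : ℕ =>
        (((Finset.range n).filter fun j => window x (j * s) N = u).card : ℝ) / n) atTop (𝓝 (μ u))) :
    IsIncompressible (sft M) x := by
  classical
  rintro ⟨Q, _, T, ⟨-, hfun, hbdd⟩, q, v, hrun, hratio⟩
  have hl := h.lam_pos
  obtain ⟨K, hK⟩ := exists_card_compressed_factors_le hfun hbdd hx hrun
  obtain ⟨C', hC', hpaths⟩ := h.exists_card_paths_le
  -- a bound `c < 1` for the compression ratio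
  obtain ⟨c, hc0, hc1, hc⟩ : ∃ c : ℝ, 0 < c ∧ c < 1 ∧
      ∃ᶠ n : ℕ in atTop, ((concatPrefix v n).length : ℝ) < c * n := by
    obtain ⟨c, hc, hc1⟩ := exists_between (max_lt hratio one_pos)
    refine ⟨c, (le_max_right _ _).trans_lt hc, hc1, ?_⟩
    obtain ⟨D, hD⟩ := Transducer.exists_length_le hrun
    -- the quotients are bounded, so that their lower limit is not a junk value
    have hbd : IsBoundedUnder (· ≤ ·) atTop
        fun n : ℕ => ((concatPrefix v n).length : ℝ) / n := by
      refine isBoundedUnder_of ⟨D, fun n => div_le_of_le_mul₀ (by positivity) (by positivity) ?_⟩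
      exact_mod_cast hD n
    have := frequently_lt_of_liminf_lt hbd.isCoboundedUnder_ge ((le_max_left _ _).trans_lt hc)
    refine (this.and_eventually (eventually_gt_atTop 0)).mono fun n hn => ?_
    exact (div_lt_iff₀ (by exact_mod_cast hn.2)).1 hn.1
  set ε := (1 - c) / 4 with hε
  have hε0 : 0 < ε := by linarith
  -- windows of length `k * j` with output of length at most `(k - 1) * j` are rare for large `j`
  obtain ⟨k, hk⟩ := exists_nat_gt (1 / ε)
  have hk0 : (0 : ℝ) < k := (by positivity : (0 : ℝ) < 1 / ε).trans hk
  have hkε : 1 < ε * k := by rwa [div_lt_iff₀' hε0] at hk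
  obtain ⟨k, rfl⟩ : ∃ k', k = k' + 1 := ⟨k - 1, by have : 0 < k := by exact_mod_cast hk0
                                                   lia⟩
  have hlim : Tendsto (fun j : ℕ => K * C' * C * ((k : ℝ) * (j ^ 1 / lam ^ j) + j ^ 0 / lam ^ j))
      atTop (𝓝 (K * C' * C * ((k : ℝ) * 0 + 0))) :=
    (((tendsto_pow_const_div_const_pow_of_one_lt 1 h.one_lt).const_mul _).add
      (tendsto_pow_const_div_const_pow_of_one_lt 0 h.one_lt)).const_mul _
  rw [mul_zero, add_zero, mul_zero] at hlim
  obtain ⟨j, hj, hj1⟩ := ((hlim.eventually (gt_mem_nhds hε0)).and (eventually_ge_atTop 1)).exists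
  set N := (k + 1) * j with hN
  set L := k * j with hL
  have hN1 : 1 ≤ N := Nat.mul_pos k.succ_pos hj1
  have hLN : (1 - ε) * N ≤ L := by
    have : (0 : ℝ) ≤ j := by positivity
    rw [hN, hL]
    push_cast at hkε ⊢
    nlinarith
  set B : Finset (List A) := (words A N).filter fun u =>
    ∃ t, window x t N = u ∧ (window v t N).flatten.length ≤ L with hB
  have hBcard : (B.card : ℝ) ≤ K * ((L + 1) * (C' * lam ^ L)) := by
    have h1 := hK N L B fun u hu => (Finset.mem_filter.1 hu).2
    have h2 : ((∑ m ∈ Finset.range (L + 1), (paths M m).card : ℕ) : ℝ) ≤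
        (L + 1) * (C' * lam ^ L) := by
      push_cast
      calc ∑ m ∈ Finset.range (L + 1), ((paths M m).card : ℝ)
          ≤ ∑ _m ∈ Finset.range (L + 1), C' * lam ^ L := by
            refine Finset.sum_le_sum fun m hm => (hpaths m).trans ?_
            have := pow_le_pow_right₀ h.one_lt.le (Nat.lt_succ_iff.1 (Finset.mem_range.1 hm))
            gcongr
        _ = _ := by simp
    calc (B.card : ℝ) ≤ ((K * ∑ m ∈ Finset.range (L + 1), (paths M m).card : ℕ) : ℝ) := by
          exact_mod_cast h1
      _ ≤ _ := by rw [Nat.cast_mul]; gcongr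
  have hBμ : ∑ u ∈ B, μ u < ε := by
    calc ∑ u ∈ B, μ u ≤ ∑ _u ∈ B, C / lam ^ N := by
          refine Finset.sum_le_sum fun u hu => ?_
          have hlen := mem_words.1 (Finset.mem_filter.1 hu).1
          rw [← hlen]
          exact hμ u (List.length_pos_iff.1 (by lia))
      _ = B.card * (C / lam ^ N) := by simp
      _ ≤ K * ((L + 1) * (C' * lam ^ L)) * (C / lam ^ N) := by gcongr
      _ = K * C' * C * ((k : ℝ) * (j ^ 1 / lam ^ j) + j ^ 0 / lam ^ j) := by
          rw [show N = L + j by rw [hN, hL]; ring, pow_add, hL]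
          have : lam ≠ 0 := hl.ne'
          push_cast
          field_simp
      _ < ε := hj
  obtain ⟨s, e, hs, hse, hfreq⟩ := hfreq N hN1
  have hBfreq : ∀ᶠ n : ℕ in atTop,
      (((Finset.range n).filter fun j => window x (j * s) N ∈ B).card : ℝ) ≤ ε * n := by
    have h1 := tendsto_finsetSum B fun u hu => hfreq u (mem_words.1 (Finset.mem_filter.1 hu).1)
    filter_upwards [h1.eventually (gt_mem_nhds hBμ), eventually_gt_atTop 0] with n hn hn0
    have hn0' : (0 : ℝ) < n := by exact_mod_cast hn0
    rw [← Finset.sum_div, div_lt_iff₀ hn0'] at hn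
    refine le_trans (le_of_eq ?_) hn.le
    have h2 : ((Finset.range n).filter fun j => window x (j * s) N ∈ B).card =
        ∑ u ∈ B, ((Finset.range n).filter fun j => window x (j * s) N = u).card := by
      rw [Finset.card_eq_sum_card_fiberwise (f := fun j => window x (j * s) N) (t := B)]
      · refine Finset.sum_congr rfl fun u hu => ?_
        congr 1
        ext j
        simp only [Finset.mem_filter]
        constructor
        · exact fun h => ⟨h.1.1, h.2⟩
        · exact fun h => ⟨⟨h.1, h.2 ▸ hu⟩, h.2⟩
      · intro j hj
        exact (Finset.mem_filter.1 (Finset.mem_coe.1 hj)).2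
    exact_mod_cast h2
  -- hence the total output of the first windows is large
  have hout : ∀ᶠ n : ℕ in atTop,
      (1 - ε) * (1 - ε) * (s * n) ≤ (concatPrefix v (s * (n + e))).length := by
    filter_upwards [hBfreq] with n hn
    have h1 : L * ((Finset.range n).filter fun j => window x (j * s) N ∉ B).card ≤
        ∑ j ∈ Finset.range n, (window v (j * s) N).flatten.length := by
      rw [mul_comm, ← smul_eq_mul, ← Finset.sum_const, Finset.sum_filter]
      refine Finset.sum_le_sum fun j _ => ?_
      split_ifs with hj
      · exact Nat.zero_le _
      · by_contra! hlt
        exact hj (Finset.mem_filter.2 ⟨mem_words.2 (length_window _ _ _), _, rfl, hlt.le⟩)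
    rw [hse] at h1
    have h2 := h1.trans (sum_length_window_le v s e n)
    rw [← hse] at h2
    have h3 := Finset.card_filter_add_card_filter_not (s := Finset.range n)
      fun j => window x (j * s) N ∈ B
    rw [Finset.card_range] at h3
    have h3' : (((Finset.range n).filter fun j => window x (j * s) N ∈ B).card : ℝ) +
      ((Finset.range n).filter fun j => window x (j * s) N ∉ B).card = n := by exact_mod_cast h3
    have h2' : (L : ℝ) * ((Finset.range n).filter fun j => window x (j * s) N ∉ B).card ≤
      e * (concatPrefix v (s * (n + e))).length := by exact_mod_cast h2
    have he0 : (0 : ℝ) < e := by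
      have : 0 < e := Nat.pos_of_ne_zero fun h0 => by simp [h0] at hse; lia
      exact_mod_cast this
    refine le_of_mul_le_mul_left ?_ he0
    calc e * ((1 - ε) * (1 - ε) * (s * n)) = ((1 - ε) * N) * ((1 - ε) * n) := by
          rw [hse]; push_cast; ring
      _ ≤ L * ((Finset.range n).filter fun j => window x (j * s) N ∉ B).card := by
          refine mul_le_mul hLN (by linarith) ?_ (by positivity)
          exact mul_nonneg (by linarith) (by positivity)
      _ ≤ _ := h2'
  obtain ⟨n₁, hn₁⟩ := eventually_atTop.1 hout
  obtain ⟨n₂, hn₂⟩ := exists_nat_gt (s * (e + 1) / ε)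
  obtain ⟨n, hn, hcn⟩ := frequently_atTop.1 hc (max n₂ (s * (n₁ + e)))
  have hne : n₁ + e ≤ n / s :=
    (Nat.le_div_iff_mul_le hs).2 (by rw [mul_comm]; exact (le_max_right _ _).trans hn)
  have h1 := hn₁ (n / s - e) (by lia)
  have h2 : s * (n / s - e + e) ≤ n := by
    rw [Nat.sub_add_cancel (by lia)]
    exact Nat.mul_div_le n s
  have h3 : ((concatPrefix v (s * (n / s - e + e))).length : ℝ) ≤ (concatPrefix v n).length := by
    exact_mod_cast (concatPrefix_prefix v h2).length_le
  have h4 : (n : ℝ) - s * (e + 1) ≤ s * ((n / s - e : ℕ) : ℝ) := by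
    have : n < s * (n / s + 1) := by
      have := Nat.lt_div_mul_add (a := n) hs
      linarith
    have h5 : n / s = (n / s - e) + e := by lia
    have h6 : (n : ℝ) ≤ s * (((n / s - e : ℕ) : ℝ) + e + 1) := by
      rw [h5] at this
      exact_mod_cast this.le
    linarith
  have h5 : s * (e + 1) / ε < n := hn₂.trans_le (by exact_mod_cast (le_max_left _ _).trans hn)
  rw [div_lt_iff₀ hε0] at h5
  have hε1 : ε ≤ 1 / 4 := by linarith
  have h6 : (1 - ε) * (1 - ε) * (n - s * (e + 1)) ≤ c * n :=
    (mul_le_mul_of_nonneg_left h4 (mul_nonneg (by linarith) (by linarith))).trans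
      (h1.trans (h3.trans hcn.le))
  have hn0 : (0 : ℝ) ≤ n := Nat.cast_nonneg n
  have hse0 : (0 : ℝ) ≤ s * (e + 1) := by positivity
  have h7 : (1 - ε) * (1 - ε) * (s * (e + 1)) ≤ s * (e + 1) :=
    mul_le_of_le_one_left hse0 (mul_le_one₀ (by linarith) (by linarith) (by linarith))
  have h8 : (1 - ε) * (1 - ε) * n = n - 2 * (ε * n) + ε ^ 2 * n := by ring
  have h9 : c * n = n - 4 * (ε * n) := by rw [show c = 1 - 4 * ε by linarith]; ring
  rw [mul_sub, h8, h9] at h6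
  linarith [mul_nonneg hε0.le hn0, mul_nonneg (sq_nonneg ε) hn0]

end Incompressible

/-! ### Codes made of loops -/

section Loops

variable {A : Type*} {M : Matrix A A ℝ} {a₀ : A}

/-- The word `c` is the label of a path that starts at `a₀` and can be continued by `a₀`. Such words
can be concatenated freely. -/
def IsLoop (M : Matrix A A ℝ) (a₀ : A) (c : List A) : Prop :=
  c.head? = some a₀ ∧ IsPath M (c ++ [a₀])

theorem IsLoop.ne_nil {c : List A} (h : IsLoop M a₀ c) : c ≠ [] := by
  rintro rfl
  simp [IsLoop] at h

theorem isPath_append_of_isLoop {c c' : List A} (h : IsPath M (c ++ [a₀]))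
    (h' : IsLoop M a₀ c') : IsPath M (c ++ c' ++ [a₀]) := by
  obtain ⟨t, rfl⟩ := List.head?_eq_some_iff.1 h'.1
  rw [List.append_assoc, List.cons_append]
  exact List.isChain_split.2 ⟨h, h'.2⟩

theorem IsLoop.append {c c' : List A} (h : IsLoop M a₀ c) (h' : IsLoop M a₀ c') :
    IsLoop M a₀ (c ++ c') := by
  refine ⟨?_, isPath_append_of_isLoop h.2 h'⟩
  rw [List.head?_append_of_ne_nil _ h.ne_nil, h.1]

theorem isPath_join {p u s : List A} {a : A} (hne : u ≠ []) (hp : IsPath M (p ++ [u.headD a]))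
    (hu : IsPath M u) (hs : IsPath M (u.getLastD a :: s)) : IsPath M (p ++ u ++ s) := by
  have h1 : IsPath M (u ++ s) := by
    obtain ⟨w, e, rfl⟩ := (List.eq_nil_or_concat u).resolve_left hne
    simp only [List.concat_eq_append, List.getLastD_concat, List.append_assoc,
      List.singleton_append] at hu hs ⊢
    exact List.isChain_split.2 ⟨hu, hs⟩
  obtain ⟨b, t, rfl⟩ := List.exists_cons_of_ne_nil hne
  rw [List.append_assoc]
  exact List.isChain_split.2 ⟨hp, h1⟩

theorem exists_injOn_of_card_le {α β : Type*} [Nonempty β] {s : Finset α} {t : Finset β}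
    (h : s.card ≤ t.card) : ∃ f : α → β, (∀ a ∈ s, f a ∈ t) ∧ Set.InjOn f s := by
  obtain ⟨f, hf, hinj⟩ := s.finite_toSet.exists_injOn_of_encard_le (t := (t : Set β))
    (by rw [Set.encard_coe_eq_coe_finsetCard, Set.encard_coe_eq_coe_finsetCard]; exact_mod_cast h)
  exact ⟨f, fun a ha => hf ha, hinj⟩

variable [Fintype A] [DecidableEq A] {lam : ℝ} {r : A → ℝ}

theorem IsPerron.exists_connecting_path (h : IsPerron M lam r) (hirr : M.IsIrreducible) (a b : A) :
    ∃ s, IsPath M (a :: s ++ [b]) := by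
  obtain ⟨k, hk, hab⟩ := (Matrix.isIrreducible_iff_exists_pow_pos hirr.nonneg).1 hirr a b
  obtain ⟨k, rfl⟩ : ∃ k', k = k' + 1 := ⟨k - 1, by lia⟩
  by_contra! hcon
  have h1 : (parryMatrix M lam r ^ (k + 1)) a b = 0 := by
    rw [← sum_pathProb_concat]
    exact Finset.sum_eq_zero fun u _ => h.pathProb_of_not_isPath (hcon u)
  rw [h.parryMatrix_pow_apply] at h1
  have := mul_pos hab (h.pos b)
  have h2 := mul_pos (pow_pos h.lam_pos (k + 1)) (h.pos a)
  exact (div_pos this h2).ne' h1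

open Classical in
/-- There are as many loops at `a₀` as paths, up to a bounded change of the length: by the
pigeonhole principle, many paths have the same end letters, and these can be closed up
by the same connecting paths. -/
theorem IsPerron.exists_card_loops_ge (h : IsPerron M lam r) (hirr : M.IsIrreducible) (a₀ : A) :
    ∃ G : ℕ, ∀ n : ℕ, ∃ n' ≤ n + G,
      lam ^ n ≤ (((words A n').filter (IsLoop M a₀)).card : ℝ) := by
  have : Nonempty A := ⟨a₀⟩
  choose s hs using h.exists_connecting_path hirr
  obtain ⟨D, hD⟩ := (Set.finite_range fun p : A × A => (s p.1 p.2).length).bddAbove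
  have hD : ∀ a b, (s a b).length ≤ D := fun a b => hD ⟨(a, b), rfl⟩
  obtain ⟨c, hc, hcard⟩ := h.exists_le_card_paths
  obtain ⟨g, hg⟩ := pow_unbounded_of_one_lt ((Fintype.card (A × A) : ℝ) / c) h.one_lt
  rw [div_lt_iff₀ hc] at hg
  refine ⟨g + 1 + (2 * D + 1), fun n => ?_⟩
  have hpos := pow_pos h.lam_pos n
  obtain ⟨⟨a, b⟩, -, hab⟩ := Finset.exists_le_card_fiber_of_nsmul_le_card_of_maps_to
    (s := paths M (n + g + 1)) (t := (Finset.univ : Finset (A × A)))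
    (f := fun u => (u.headD a₀, u.getLastD a₀)) (b := lam ^ n) (fun _ _ => Finset.mem_univ _)
    Finset.univ_nonempty (by
      rw [Finset.card_univ, nsmul_eq_mul]
      refine le_trans ?_ (hcard (n + g))
      rw [pow_add]
      nlinarith)
  refine ⟨(s a₀ a).length + 1 + (n + g + 1) + (s b a₀).length, ?_, hab.trans ?_⟩
  · have := hD a₀ a
    have := hD b a₀
    lia
  · norm_cast
    refine Finset.card_le_card_of_injOn (fun u => a₀ :: s a₀ a ++ u ++ s b a₀) ?_ ?_
    · intro u hu
      obtain ⟨hu', hab⟩ := Finset.mem_filter.1 (Finset.mem_coe.1 hu)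
      obtain ⟨hlen, hpath⟩ := mem_paths.1 hu'
      have hne : u ≠ [] := List.length_pos_iff.1 (by lia)
      obtain ⟨rfl, rfl⟩ := Prod.mk.inj hab
      rw [Finset.mem_coe, Finset.mem_filter, mem_words]
      refine ⟨by simp [hlen]; lia, by simp, ?_⟩
      rw [List.append_assoc]
      exact isPath_join hne (hs _ _) hpath (hs _ _)
    · intro u _ v _ huv
      simpa using huv

/-- A prefix code for the paths with `N` vertices, made of loops, which takes essentially `N - K`
letters on a set `B` of at most `lam ^ (N - K)` paths and essentially `N` letters otherwise. Two
different loops of the same length mark the two cases. -/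
theorem IsPerron.exists_loop_code (h : IsPerron M lam r) (hirr : M.IsIrreducible) (a₀ : A) :
    ∃ G : ℕ, ∀ (N K : ℕ) (B : Finset (List A)), (B.card : ℝ) ≤ lam ^ (N - K) →
      ∃ φ : List A → List A, (∀ u ∈ paths M N, IsLoop M a₀ (φ u)) ∧
        (∀ u ∈ paths M N, ∀ v ∈ paths M N, φ u <+: φ v → u = v) ∧
        (∀ u ∈ paths M N, u ∉ B → (φ u).length ≤ N + G) ∧
        (∀ u ∈ paths M N, u ∈ B → (φ u).length ≤ N - K + G) := by
  classical
  obtain ⟨G, hG⟩ := h.exists_card_loops_ge hirr a₀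
  obtain ⟨C, hC, hcard⟩ := h.exists_card_paths_le
  obtain ⟨g, hg⟩ := pow_unbounded_of_one_lt C h.one_lt
  obtain ⟨k, hk⟩ := pow_unbounded_of_one_lt 1 h.one_lt
  obtain ⟨n₀, -, hn₀⟩ := hG k
  obtain ⟨m₁, hm₁, m₂, hm₂, hne⟩ := Finset.one_lt_card.1
    (by exact_mod_cast hk.trans_le hn₀ :
      1 < ((words A n₀).filter (IsLoop M a₀)).card)
  simp only [Finset.mem_filter, mem_words] at hm₁ hm₂
  refine ⟨n₀ + g + G, fun N K B hB => ?_⟩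
  obtain ⟨n₁, hn₁, hn₁'⟩ := hG (N + g)
  obtain ⟨n₂, hn₂, hn₂'⟩ := hG (N - K)
  have hpos := pow_pos h.lam_pos N
  obtain ⟨f₁, hf₁, hinj₁⟩ := exists_injOn_of_card_le (s := paths M N)
    (t := (words A n₁).filter (IsLoop M a₀)) (by
      have : ((paths M N).card : ℝ) ≤ lam ^ (N + g) := by
        rw [pow_add, mul_comm]
        exact (hcard N).trans (by gcongr)
      exact_mod_cast this.trans hn₁')
  obtain ⟨f₂, hf₂, hinj₂⟩ := exists_injOn_of_card_le (s := B)
    (t := (words A n₂).filter (IsLoop M a₀)) (by exact_mod_cast hB.trans hn₂')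
  simp only [Finset.mem_filter, mem_words] at hf₁ hf₂
  refine ⟨fun u => if u ∈ B then m₂ ++ f₂ u else m₁ ++ f₁ u, fun u hu => ?_,
    fun u hu v hv huv => ?_, fun u hu hB => ?_, fun u hu hB => ?_⟩
  · dsimp only
    split_ifs with huB
    · exact hm₂.2.append (hf₂ u huB).2
    · exact hm₁.2.append (hf₁ u hu).2
  · have hmark : ∀ {l l' : List A} {m m' : List A}, m.length = m'.length → m ++ l <+: m' ++ l' →
        m = m' := by
      intro l l' m m' hlen hpre
      exact (List.prefix_of_prefix_length_le ((List.prefix_append m l).trans hpre)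
        (List.prefix_append m' l') hlen.le).eq_of_length hlen
    dsimp only at huv
    split_ifs at huv with huB hvB hvB
    · rw [List.prefix_append_right_inj] at huv
      exact hinj₂ huB hvB (huv.eq_of_length ((hf₂ u huB).1.trans (hf₂ v hvB).1.symm))
    · exact absurd (hmark (hm₂.1.trans hm₁.1.symm) huv).symm hne
    · exact absurd (hmark (hm₁.1.trans hm₂.1.symm) huv) hne
    · rw [List.prefix_append_right_inj] at huv
      exact hinj₁ hu hv (huv.eq_of_length ((hf₁ u hu).1.trans (hf₁ v hv).1.symm))
  · have := (hf₁ u hu).1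
    simp only [if_neg hB, List.length_append]
    lia
  · have := (hf₂ u hB).1
    simp only [if_pos hB, List.length_append]
    lia

end Loops

/-! ### Block transducers -/

section BlockTransducer

/-- The same transducer, with renamed states. -/
def Transducer.rename {Q Q' A B : Type*} (T : Transducer Q A B) (e : Q ≃ Q') :
    Transducer Q' A B where
  trans := (fun p => (e p.1, p.2.1, p.2.2.1, e p.2.2.2)) '' T.trans
  finite_trans := T.finite_trans.image _
  initial := e '' T.initial
  final := e '' T.final

theorem Transducer.isAcceptingRun_rename {Q Q' A B : Type*} {T : Transducer Q A B} (e : Q ≃ Q')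
    {q : ℕ → Q'} {x : ℕ → A} {v : ℕ → List B} :
    (T.rename e).IsAcceptingRun q x v ↔ T.IsAcceptingRun (fun n => e.symm (q n)) x v := by
  have h1 : ∀ (S : Set Q) s, s ∈ e '' S ↔ e.symm s ∈ S := fun S s => Set.mem_image_equiv
  refine and_congr (h1 _ _) (and_congr (forall_congr' fun n => ?_) ?_)
  · constructor
    · rintro ⟨⟨p, a, w, p'⟩, hp, he⟩
      simp only [Prod.mk.injEq] at he
      obtain ⟨h1, rfl, rfl, h2⟩ := he
      simpa [← h1, ← h2] using hp
    · exact fun h => ⟨_, h, by simp⟩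
  · simp only [Transducer.rename, h1]

/-- A compressor whose states form a finite type of any universe witnesses compressibility. -/
theorem Transducer.IsCompressor.isCompressible {Q : Type*} {A : Type*} [Finite Q]
    {T : Transducer Q A A} {X : Set (ℕ → A)} (hT : T.IsCompressor X X) {x : ℕ → A} {q : ℕ → Q}
    {v : ℕ → List A} (hrun : T.IsAcceptingRun q x v) (hv : compressionRatio v < 1) :
    IsCompressible X x := by
  obtain ⟨n, ⟨e⟩⟩ := Finite.exists_equiv_fin Q
  have hr := @Transducer.isAcceptingRun_rename _ _ _ _ T e
  have hlift : ∀ {q x v}, T.IsAcceptingRun q x v →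
      (T.rename e).IsAcceptingRun (fun n => e (q n)) x v := fun h => hr.2 (by simpa using h)
  obtain ⟨htrim, ⟨huniq, hfun⟩, K, hK⟩ := hT
  refine ⟨Fin n, inferInstance, T.rename e, ⟨fun s => ?_, ⟨fun x hx q v q' v' h h' => ?_,
    fun x hx q v h => hfun x hx _ v (hr.1 h)⟩, K, fun y => ?_⟩, _, v, hlift hrun, hv⟩
  · obtain ⟨q, x, v, h, n, hn⟩ := htrim (e.symm s)
    exact ⟨_, x, v, hlift h, n, by simp [hn]⟩
  · obtain ⟨h1, h2⟩ := huniq x hx _ v _ v' (hr.1 h) (hr.1 h')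
    exact ⟨funext fun n => e.symm.injective (congrFun h1 n), h2⟩
  · refine le_trans (Set.encard_le_encard ?_) (hK y)
    rintro x ⟨hx, q, v, h, hy⟩
    exact ⟨hx, _, v, hr.1 h, hy⟩

variable {A : Type*} {N : ℕ} {φ : List A → List A}

/-- The state reached from the state `s` of a block transducer after reading the letter `a`. -/
def blockNext (hN : 0 < N) (s : {s : List A // s.length < N}) (a : A) :
    {s : List A // s.length < N} :=
  if h : (s.1 ++ [a]).length < N then ⟨s.1 ++ [a], h⟩ else ⟨[], hN⟩

/-- The output of a block transducer that reads the letter `a` in the state `s`. -/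
def blockOut (N : ℕ) (φ : List A → List A) (s : List A) (a : A) : List A :=
  if (s ++ [a]).length < N then [] else φ (s ++ [a])

/-- The deterministic transducer that replaces each of the consecutive blocks `u` of length `N` of
its input by `φ u`. The states are the proper prefixes of the blocks. -/
def blockTransducer [Finite A] (hN : 0 < N) (φ : List A → List A) :
    Transducer {s : List A // s.length < N} A A where
  trans := Set.range fun p : {s : List A // s.length < N} × A =>
    (p.1, p.2, blockOut N φ p.1 p.2, blockNext hN p.1 p.2)
  finite_trans := by
    have : Finite {s : List A // s.length < N} := List.finite_length_lt A N
    exact Set.finite_range _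
  initial := {⟨[], hN⟩}
  final := Set.univ

theorem isAcceptingRun_blockTransducer [Finite A] (hN : 0 < N)
    {q : ℕ → {s : List A // s.length < N}} {x : ℕ → A} {v : ℕ → List A} :
    (blockTransducer hN φ).IsAcceptingRun q x v ↔ q 0 = ⟨[], hN⟩ ∧
      (∀ n, q (n + 1) = blockNext hN (q n) (x n)) ∧ ∀ n, v n = blockOut N φ (q n) (x n) := by
  have : (∃ᶠ n in atTop, q n ∈ (blockTransducer hN φ).final) ↔ True :=
    iff_true_intro (Frequently.of_forall fun n => Set.mem_univ _)
  rw [Transducer.IsAcceptingRun, this, and_true, ← forall_and]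
  refine and_congr Iff.rfl (forall_congr' fun n => ?_)
  constructor
  · rintro ⟨⟨s, a⟩, h⟩
    simp only [Prod.mk.injEq] at h
    obtain ⟨rfl, rfl, h1, h2⟩ := h
    exact ⟨h2.symm, h1.symm⟩
  · rintro ⟨h1, h2⟩
    exact ⟨(q n, x n), by rw [h1, h2]⟩

theorem exists_isAcceptingRun_blockTransducer [Finite A] (hN : 0 < N) (x : ℕ → A) :
    ∃ q v, (blockTransducer hN φ).IsAcceptingRun q x v := by
  let q : ℕ → {s : List A // s.length < N} :=
    fun n => Nat.rec ⟨[], hN⟩ (fun n s => blockNext hN s (x n)) n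
  refine ⟨q, fun n => blockOut N φ (q n).1 (x n), ?_⟩
  rw [isAcceptingRun_blockTransducer]
  exact ⟨rfl, fun _ => rfl, fun _ => rfl⟩

theorem isAcceptingRun_blockTransducer_unique [Finite A] (hN : 0 < N)
    {q q' : ℕ → {s : List A // s.length < N}} {x : ℕ → A} {v v' : ℕ → List A}
    (h : (blockTransducer hN φ).IsAcceptingRun q x v)
    (h' : (blockTransducer hN φ).IsAcceptingRun q' x v') : q = q' ∧ v = v' := by
  rw [isAcceptingRun_blockTransducer] at h h'
  have hq : ∀ n, q n = q' n := by
    intro n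
    induction n with
    | zero => rw [h.1, h'.1]
    | succ n ih => rw [h.2.1, h'.2.1, ih]
  exact ⟨funext hq, funext fun n => by rw [h.2.2, h'.2.2, hq]⟩

/-- The code words of the consecutive blocks of length `N` of `x`. -/
def codeBlocks (N : ℕ) (φ : List A → List A) (x : ℕ → A) (i : ℕ) : List A :=
  φ (window x (i * N) N)

theorem blockTransducer_run [Finite A] (hN : 0 < N) {q : ℕ → {s : List A // s.length < N}}
    {x : ℕ → A} {v : ℕ → List A} (h : (blockTransducer hN φ).IsAcceptingRun q x v) (n : ℕ) :
    (q n).1 = window x (n / N * N) (n % N) ∧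
      concatPrefix v n = concatPrefix (codeBlocks N φ x) (n / N) := by
  rw [isAcceptingRun_blockTransducer] at h
  obtain ⟨h0, hq, hv⟩ := h
  induction n with
  | zero => simp [h0, concatPrefix]
  | succ n ih =>
    have hlt := Nat.mod_lt n hN
    have hdm : n / N * N + n % N = n := Nat.div_add_mod' n N
    have hs : (q n).1 ++ [x n] = window x (n / N * N) (n % N + 1) := by
      rw [window_succ, ← ih.1, hdm]
    rw [concatPrefix_succ, ih.2, hq, hv, blockNext, blockOut]
    by_cases hc : n % N + 1 < N
    · have hdiv : (n + 1) / N = n / N :=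
        Nat.div_eq_of_lt_le (by lia) (by rw [Nat.succ_mul]; lia)
      have hmod : (n + 1) % N = n % N + 1 := by
        have := Nat.div_add_mod' (n + 1) N
        rw [hdiv] at this
        lia
      have hc' : ((q n).1 ++ [x n]).length < N := by rw [hs, length_window]; exact hc
      rw [dif_pos hc', if_pos hc', hdiv, hmod]
      exact ⟨hs, List.append_nil _⟩
    · have he : n % N + 1 = N := by lia
      have hdiv : (n + 1) / N = n / N + 1 := by
        refine Nat.div_eq_of_lt_le ?_ ?_ <;> rw [Nat.succ_mul] <;> try rw [Nat.succ_mul]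
        all_goals lia
      have hmod : (n + 1) % N = 0 := by
        have := Nat.div_add_mod' (n + 1) N
        rw [hdiv, Nat.succ_mul] at this
        lia
      have hc' : ¬ ((q n).1 ++ [x n]).length < N := by rw [hs, length_window]; exact hc
      rw [dif_neg hc', if_neg hc', hdiv, hmod, concatPrefix_succ, hs, he]
      exact ⟨rfl, rfl⟩

theorem exists_isConcat {B : Type*} {v : ℕ → List B}
    (hlim : Tendsto (fun n => (concatPrefix v n).length) atTop atTop) : ∃ y, IsConcat v y := by
  have h : ∀ i, ∃ n, i < (concatPrefix v n).length :=
    fun i => (hlim.eventually_gt_atTop i).exists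
  choose m hm using h
  refine ⟨fun i => (concatPrefix v (m i))[i]'(hm i), hlim, fun n => ?_⟩
  refine List.ext_getElem (by simp [seqPrefix]) fun i h1 h2 => ?_
  simp only [seqPrefix, List.getElem_map, List.getElem_range]
  rcases le_total n (m i) with hle | hle
  · exact (concatPrefix_prefix v hle).getElem h1
  · exact ((concatPrefix_prefix v hle).getElem (hm i)).symm

theorem le_length_concatPrefix {B : Type*} {v : ℕ → List B} (h : ∀ i, v i ≠ []) (n : ℕ) :
    n ≤ (concatPrefix v n).length := by
  rw [length_concatPrefix]
  calc n = ∑ _i ∈ Finset.range n, 1 := by simp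
    _ ≤ _ := Finset.sum_le_sum fun i _ => List.length_pos_iff.2 (h i)

/-- A prefix code on the blocks of length `N` whose code words are loops gives an injective
compressor, and `x` is compressible if the code shortens its blocks on average, infinitely often. -/
theorem isCompressible_of_code [Finite A] [DecidableEq A] {M : Matrix A A ℝ} {a₀ : A} (hN : 0 < N)
    (hloop : ∀ x ∈ sft M, ∀ i, IsLoop M a₀ (φ (window x i N)))
    (hpre : ∀ x ∈ sft M, ∀ y ∈ sft M, ∀ i j,
      φ (window x i N) <+: φ (window y j N) → window x i N = window y j N)
    {x : ℕ → A} {c : ℝ} (hc : c < 1)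
    (hlen : ∃ᶠ m in atTop, ((concatPrefix (codeBlocks N φ x) m).length : ℝ) ≤ c * (m * N)) :
    IsCompressible (sft M) x := by
  have : Finite {s : List A // s.length < N} := List.finite_length_lt A N
  obtain ⟨q, v, hrun⟩ := exists_isAcceptingRun_blockTransducer (φ := φ) hN x
  have hrec : ∀ {x : ℕ → A} {q v}, (blockTransducer hN φ).IsAcceptingRun q x v → ∀ m,
      concatPrefix v (m * N) = concatPrefix (codeBlocks N φ x) m := by
    intro x q v h m
    rw [(blockTransducer_run hN h _).2, Nat.mul_div_cancel _ hN]
  refine Transducer.IsCompressor.isCompressible (T := blockTransducer hN φ)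
    ⟨fun s => ?_, ⟨fun x _ q v q' v' h h' => isAcceptingRun_blockTransducer_unique hN h h',
      fun x hx q v h => ?_⟩, 1, fun y => ?_⟩ hrun ?_
  · -- the state `s` is reached by reading `s`
    obtain ⟨q, v, h⟩ := exists_isAcceptingRun_blockTransducer (φ := φ) hN
      fun t => s.1[t]?.getD a₀
    refine ⟨q, _, v, h, s.1.length, Subtype.ext ?_⟩
    rw [(blockTransducer_run hN h _).1, Nat.div_eq_of_lt s.2, Nat.mod_eq_of_lt s.2]
    refine List.ext_getElem (by simp) fun i h1 h2 => ?_
    simp [h2]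
  · have hlim : Tendsto (fun n => (concatPrefix v n).length) atTop atTop := by
      refine tendsto_atTop_mono (f := fun n => n / N) (fun n => ?_)
        (Nat.tendsto_div_const_atTop hN.ne')
      rw [(blockTransducer_run hN h n).2]
      exact le_length_concatPrefix (fun i => (hloop x hx _).ne_nil) _
    obtain ⟨y, hy⟩ := exists_isConcat hlim
    have hpath : ∀ m, IsPath M (concatPrefix (codeBlocks N φ x) m ++ [a₀]) := by
      intro m
      induction m with
      | zero => exact List.isChain_singleton _
      | succ m ih =>
        rw [concatPrefix_succ]
        exact isPath_append_of_isLoop ih (hloop x hx _)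
    refine ⟨y, fun i => ?_, hy⟩
    obtain ⟨n, hn⟩ := (hlim.eventually_gt_atTop (i + 1)).exists
    have h1 : IsPath M (concatPrefix v n) := by
      rw [(blockTransducer_run hN h n).2]
      exact (hpath _).left_of_append
    rw [hy.2, IsPath, List.isChain_iff_getElem] at h1
    have h2 := h1 i (by simpa [seqPrefix] using hn)
    simpa [seqPrefix] using h2
  · rw [Nat.cast_one, Set.encard_le_one_iff]
    rintro z z' ⟨hz, q, v, h, hy⟩ ⟨hz', q', v', h', hy'⟩
    have hcat : ∀ m, concatPrefix (codeBlocks N φ z) m = concatPrefix (codeBlocks N φ z') m →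
        window z (m * N) N = window z' (m * N) N := by
      intro m hm
      have e1 := hy.2 ((m + 1) * N)
      have e2 := hy'.2 ((m + 1) * N)
      rw [hrec h, concatPrefix_succ, hm] at e1
      rw [hrec h', concatPrefix_succ] at e2
      have hle : ∀ {k l : ℕ}, k ≤ l → seqPrefix y k <+: seqPrefix y l := by
        intro k l hkl
        rw [seqPrefix_eq_window, seqPrefix_eq_window, ← take_window y 0 hkl]
        exact List.take_prefix _ _
      rcases le_total (concatPrefix (codeBlocks N φ z') m ++ codeBlocks N φ z m).length
        (concatPrefix (codeBlocks N φ z') m ++ codeBlocks N φ z' m).length with hl | hl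
      · have := hle hl
        rw [← e1, ← e2, List.prefix_append_right_inj] at this
        exact hpre z hz z' hz' _ _ this
      · have := hle hl
        rw [← e1, ← e2, List.prefix_append_right_inj] at this
        exact (hpre z' hz' z hz _ _ this).symm
    have heq : ∀ m, concatPrefix (codeBlocks N φ z) m = concatPrefix (codeBlocks N φ z') m := by
      intro m
      induction m with
      | zero => rfl
      | succ m ih =>
        rw [concatPrefix_succ, concatPrefix_succ, ih, codeBlocks, hcat m ih, codeBlocks]
    funext i
    have := window_eq_iff.1 (hcat (i / N) (heq _)) (i % N) (Nat.mod_lt i hN)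
    rwa [Nat.div_add_mod'] at this
  · refine lt_of_le_of_lt (liminf_le_of_frequently_le ?_
      (isBoundedUnder_of ⟨0, fun n => by positivity⟩)) hc
    rw [frequently_atTop] at hlen ⊢
    intro k
    obtain ⟨m, hm, hmc⟩ := hlen (k + 1)
    refine ⟨m * N, by nlinarith, ?_⟩
    have hm0 : 0 < m * N := Nat.mul_pos (by lia) hN
    rw [hrec hrun, div_le_iff₀ (by exact_mod_cast hm0)]
    exact_mod_cast hmc

end BlockTransducer

/-! ### Incompressible sequences have the transition frequencies of the Parry measure -/

section Deviation

/-- If the averages of a bounded sequence do not tend to `0`, then for some `ε > 0` and every block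
length the block averages exceed `ε` with frequency at least `ε`, infinitely often. -/
theorem exists_frequently_large_blocks {g : ℕ → ℝ} (hg : ∀ j, |g j| ≤ 1)
    (h : ¬ Tendsto (fun n : ℕ => (∑ j ∈ Finset.range n, g j) / n) atTop (𝓝 0)) :
    ∃ ε > 0, ∀ m ≥ 1, ∃ᶠ n : ℕ in atTop, ε * n ≤ (((Finset.range n).filter fun i =>
      ε * m ≤ |∑ j ∈ Finset.range m, g (i * m + j)|).card : ℝ) := by
  rw [Metric.tendsto_atTop] at h
  push Not at h
  obtain ⟨ε, hε, h⟩ := h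
  refine ⟨ε / 4, by positivity, fun m hm => frequently_atTop.2 fun k => ?_⟩
  obtain ⟨n₀, hn₀⟩ := exists_nat_gt (2 * m / ε)
  obtain ⟨n, hn, hdist⟩ := h (max n₀ (max 1 (k * m)))
  have hn0 : (0 : ℝ) < n := by
    exact_mod_cast ((le_max_left _ _).trans (le_max_right _ _)).trans hn
  have hm0 : (0 : ℝ) < m := by exact_mod_cast hm
  rw [Real.dist_eq, sub_zero, abs_div, abs_of_pos hn0, le_div_iff₀ hn0] at hdist
  have hnm : 2 * m < n * ε := by
    rw [← div_lt_iff₀ hε]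
    exact hn₀.trans_le (by exact_mod_cast (le_max_left _ _).trans hn)
  set t := n / m with ht
  have htn : t * m ≤ n := Nat.div_mul_le_self n m
  refine ⟨t, (Nat.le_div_iff_mul_le hm).2
    (((le_max_right _ _).trans (le_max_right _ _)).trans hn), ?_⟩
  set B := (Finset.range t).filter fun i =>
    ε / 4 * m ≤ |∑ j ∈ Finset.range m, g (i * m + j)| with hB
  have hblock : ∀ s : ℕ, ∑ j ∈ Finset.range (s * m), g j =
      ∑ i ∈ Finset.range s, ∑ j ∈ Finset.range m, g (i * m + j) := by
    intro s
    induction s with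
    | zero => simp
    | succ s ih => rw [Nat.succ_mul, Finset.sum_range_add, ih, Finset.sum_range_succ]
  -- the incomplete last block contributes at most `m`
  have h1 : |∑ j ∈ Finset.range n, g j| ≤ |∑ j ∈ Finset.range (t * m), g j| + m := by
    obtain ⟨e, he⟩ := Nat.exists_eq_add_of_le htn
    have hem : e ≤ m := by
      have := Nat.lt_div_mul_add (a := n) hm
      lia
    conv_lhs => rw [he]
    rw [Finset.sum_range_add]
    refine (abs_add_le _ _).trans (add_le_add le_rfl ?_)
    calc |∑ j ∈ Finset.range e, g (t * m + j)| ≤ ∑ j ∈ Finset.range e, |g (t * m + j)| :=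
          Finset.abs_sum_le_sum_abs _ _
      _ ≤ ∑ _j ∈ Finset.range e, 1 := Finset.sum_le_sum fun j _ => hg _
      _ ≤ m := by simpa using hem
  have h2 : |∑ j ∈ Finset.range (t * m), g j| ≤ B.card * m + t * (ε / 4 * m) := by
    rw [hblock]
    calc _ ≤ ∑ i ∈ Finset.range t, |∑ j ∈ Finset.range m, g (i * m + j)| :=
          Finset.abs_sum_le_sum_abs _ _
      _ ≤ ∑ i ∈ Finset.range t, ((if ε / 4 * m ≤ |∑ j ∈ Finset.range m, g (i * m + j)|
            then (m : ℝ) else 0) + ε / 4 * m) := by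
          refine Finset.sum_le_sum fun i _ => ?_
          split_ifs with hi
          · have : |∑ j ∈ Finset.range m, g (i * m + j)| ≤ m := by
              calc _ ≤ ∑ j ∈ Finset.range m, |g (i * m + j)| := Finset.abs_sum_le_sum_abs _ _
                _ ≤ ∑ _j ∈ Finset.range m, 1 := Finset.sum_le_sum fun j _ => hg _
                _ = m := by simp
            have : 0 ≤ ε / 4 * m := by positivity
            linarith
          · linarith
      _ = _ := by
          rw [Finset.sum_add_distrib, ← Finset.sum_filter, Finset.sum_const, Finset.sum_const,
            Finset.card_range, nsmul_eq_mul, nsmul_eq_mul]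
  have h3 : (t : ℝ) * m ≤ n := by exact_mod_cast htn
  have h4 : ε / 4 * t * m ≤ B.card * m := by nlinarith
  exact le_of_mul_le_mul_right h4 hm0

variable {A : Type*} [DecidableEq A]

/-- The difference between the indicator of an occurrence of `w b` at position `p` and its
conditional expectation, given the letters before the final `b`. -/
noncomputable def deviation (P : Matrix A A ℝ) (w : List A) (b : A) (x : ℕ → A) (p : ℕ) : ℝ :=
  if window x p w.length = w then (if x (p + w.length) = b then 1 else 0) - P (w.getLastD b) b
  else 0

/-- The deviation of `w b` at the positions divisible by `d`, as the increment of an additive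
functional of words: the increment belongs to the final letter of the occurrence. -/
noncomputable def deviationIncrement (P : Matrix A A ℝ) (d : ℕ) (w : List A) (b : A) (u : List A)
    (c : A) : ℝ :=
  if w.length ≤ u.length ∧ d ∣ u.length - w.length ∧ w <:+ u then
    (if c = b then 1 else 0) - P (w.getLastD b) b
  else 0

variable {P : Matrix A A ℝ} {d : ℕ} {w : List A} {b : A}

theorem abs_indicator_sub_le {A : Type*} {P : Matrix A A ℝ} (hP0 : ∀ a b, 0 ≤ P a b)
    (hP1 : ∀ a b, P a b ≤ 1) (p : Prop) [Decidable p] (a b : A) :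
    |(if p then 1 else 0) - P a b| ≤ 1 := by
  have h0 := hP0 a b
  have h1 := hP1 a b
  rw [abs_le]
  split_ifs <;> constructor <;> linarith

theorem abs_deviation_le (hP0 : ∀ a b, 0 ≤ P a b) (hP1 : ∀ a b, P a b ≤ 1) (x : ℕ → A) (p : ℕ) :
    |deviation P w b x p| ≤ 1 := by
  rw [deviation]
  split_ifs with h
  · simpa using abs_indicator_sub_le hP0 hP1 True (w.getLastD b) b
  · simpa using abs_indicator_sub_le hP0 hP1 False (w.getLastD b) b
  · simp

theorem abs_deviationIncrement_le (hP0 : ∀ a b, 0 ≤ P a b) (hP1 : ∀ a b, P a b ≤ 1) (u : List A)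
    (c : A) : |deviationIncrement P d w b u c| ≤ 1 := by
  rw [deviationIncrement]
  split_ifs with h
  · simpa using abs_indicator_sub_le hP0 hP1 True (w.getLastD b) b
  · simpa using abs_indicator_sub_le hP0 hP1 False (w.getLastD b) b
  · simp

theorem sum_mul_deviationIncrement [Fintype A] (hP1 : ∀ a, ∑ b, P a b = 1) (hw : w ≠ []) (a : A)
    (u : List A) : ∑ c, P (u.getLastD a) c * deviationIncrement P d w b (a :: u) c = 0 := by
  simp only [deviationIncrement]
  split_ifs with h
  · obtain ⟨s, hs⟩ := h.2.2
    have hlast : u.getLastD a = w.getLastD b := by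
      obtain ⟨w', e, rfl⟩ := (List.eq_nil_or_concat w).resolve_left hw
      rw [← List.getLastD_cons (a := b), ← hs]
      simp
    simp_rw [hlast, mul_sub, Finset.sum_sub_distrib, ← Finset.sum_mul, hP1]
    simp
  · simp

theorem suffix_window_iff {A : Type*} {w : List A} (x : ℕ → A) (i t : ℕ) (h : w.length ≤ t) :
    w <:+ window x i t ↔ window x (i + (t - w.length)) w.length = w := by
  have hsplit := window_add x i (t - w.length) w.length
  rw [Nat.sub_add_cancel h] at hsplit
  rw [hsplit]
  constructor
  · rintro ⟨s, hs⟩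
    exact (List.append_inj' hs (by simp)).2.symm
  · intro he
    rw [he]
    exact List.suffix_append _ _

/-- The occurrences that are not contained in a block are the only ones that the additive functional
of the block misses. -/
theorem abs_pathSum_sub_le (hP0 : ∀ a b, 0 ≤ P a b) (hP1 : ∀ a b, P a b ≤ 1) (hd : 1 ≤ d)
    (x : ℕ → A) (i m : ℕ) :
    |pathSum (deviationIncrement P d w b) (window x (i * (m * d)) (m * d)) -
      ∑ j ∈ Finset.range m, deviation P w b x ((i * m + j) * d)| ≤ w.length := by
  have h1 : pathSum (deviationIncrement P d w b) (window x (i * (m * d)) (m * d)) =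
      ∑ j ∈ (Finset.range m).filter (fun j => j * d + w.length < m * d),
        deviation P w b x ((i * m + j) * d) := by
    rw [pathSum_window]
    symm
    refine Finset.sum_of_injOn (fun j => j * d + w.length) ?_ ?_ ?_ ?_
    · intro j _ j' _ h
      exact Nat.eq_of_mul_eq_mul_right hd (Nat.add_right_cancel h)
    · intro j hj
      simpa using (Finset.mem_filter.1 (Finset.mem_coe.1 hj)).2
    · intro t ht hnot
      rw [deviationIncrement, if_neg]
      rw [length_window]
      rintro ⟨hle, ⟨j, hj⟩, -⟩
      have ht' := Finset.mem_range.1 ht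
      have htj : t = j * d + w.length := by rw [mul_comm]; lia
      refine hnot ⟨j, ?_, htj.symm⟩
      rw [Finset.mem_coe, Finset.mem_filter, Finset.mem_range, ← htj]
      refine ⟨lt_of_mul_lt_mul_right (a := d) ?_ (Nat.zero_le _), ht'⟩
      lia
    · intro j _
      have hpos : (i * m + j) * d = i * (m * d) + j * d := by ring
      have hsuf := suffix_window_iff (w := w) x (i * (m * d)) (j * d + w.length)
        (Nat.le_add_left _ _)
      rw [Nat.add_sub_cancel] at hsuf
      simp only [deviation, deviationIncrement, length_window, hpos, Nat.add_sub_cancel, hsuf,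
        Nat.le_add_left, dvd_mul_left, true_and, add_assoc]
  rw [h1, ← Finset.sum_filter_add_sum_filter_not (Finset.range m)
    (fun j => j * d + w.length < m * d), sub_add_cancel_left, abs_neg]
  refine (Finset.abs_sum_le_sum_abs _ _).trans
    ((Finset.sum_le_card_nsmul _ _ 1 fun j _ => abs_deviation_le hP0 hP1 x _).trans ?_)
  rw [nsmul_eq_mul, mul_one]
  have h2 : (Finset.range m).filter (fun j => ¬ j * d + w.length < m * d) ⊆
      Finset.Ico (m - w.length) m := by
    intro j hj
    rw [Finset.mem_filter, Finset.mem_range, not_lt] at hj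
    rw [Finset.mem_Ico]
    refine ⟨?_, hj.1⟩
    obtain ⟨e, rfl⟩ := Nat.exists_eq_add_of_lt hj.1
    have := hj.2
    have h3 : e + 1 ≤ (e + 1) * d := Nat.le_mul_of_pos_right _ hd
    have h4 : (j + e + 1) * d = j * d + (e + 1) * d := by ring
    lia
  have h3 := Finset.card_le_card h2
  rw [Nat.card_Ico] at h3
  exact_mod_cast h3.trans (by lia)

variable [Fintype A] {M : Matrix A A ℝ} {lam : ℝ} {r : A → ℝ}

/-- Otherwise a positive proportion of the blocks of `x` belongs to a set of few paths, by
Chebyshev's inequality, and a code with short code words for these compresses `x`. -/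
theorem IsPerron.tendsto_deviation (h : IsPerron M lam r) (hirr : M.IsIrreducible) {x : ℕ → A}
    (hx : x ∈ sft M) (hinc : IsIncompressible (sft M) x) (hd : 1 ≤ d) (hw : w ≠ []) (b : A) :
    Tendsto (fun n : ℕ =>
      (∑ j ∈ Finset.range n, deviation (parryMatrix M lam r) w b x (j * d)) / n) atTop (𝓝 0) := by
  classical
  by_contra hcon
  refine hinc ?_
  have hP0 := h.parryMatrix_nonneg
  have hP1 := h.parryMatrix_le_one
  have hl := h.lam_pos
  obtain ⟨ε, hε, hfreq⟩ := exists_frequently_large_blocks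
    (fun j => abs_deviation_le hP0 hP1 x (j * d)) hcon
  obtain ⟨C, hC, hcard⟩ := h.exists_card_large_pathSum_le
  obtain ⟨G, hG⟩ := h.exists_loop_code hirr (x 0)
  -- `K` letters are saved on a proportion `ε` of the blocks and `G` letters are lost on each block
  obtain ⟨K, hK⟩ := exists_nat_gt ((G + 1) / ε)
  rw [div_lt_iff₀ hε] at hK
  obtain ⟨m, hm⟩ := exists_nat_gt (2 * w.length / ε + K + 4 * C * d * lam ^ K / ε ^ 2)
  have hd0 : (0 : ℝ) < d := by exact_mod_cast hd
  have ha : 0 ≤ 2 * w.length / ε := by positivity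
  have hb : 0 ≤ 4 * C * d * lam ^ K / ε ^ 2 := by positivity
  have hK0 : (0 : ℝ) ≤ K := Nat.cast_nonneg K
  have hm1 : 2 * w.length / ε < m := by linarith
  have hm2 : (K : ℝ) ≤ m := by linarith
  have hm3 : 4 * C * d * lam ^ K / ε ^ 2 < m := by linarith
  have hm0 : (0 : ℝ) < m := ha.trans_lt hm1
  have hm0' : 1 ≤ m := by exact_mod_cast hm0
  rw [div_lt_iff₀ hε] at hm1
  rw [div_lt_iff₀ (by positivity)] at hm3
  set N := m * d with hN
  have hN0 : 0 < N := Nat.mul_pos hm0' hd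
  have hKN : K ≤ N := (by exact_mod_cast hm2 : K ≤ m).trans (Nat.le_mul_of_pos_right _ hd)
  set D := deviationIncrement (parryMatrix M lam r) d w b with hD
  set θ : ℝ := ε * m / 2 with hθ
  have hθ0 : 0 < θ := by positivity
  set B := (paths M N).filter fun u => θ ≤ |pathSum D u| with hB
  have hBcard : (B.card : ℝ) ≤ lam ^ (N - K) := by
    refine (hcard D (abs_deviationIncrement_le hP0 hP1)
      (sum_mul_deviationIncrement h.sum_parryMatrix hw) N θ hθ0).trans ?_
    have hpow : lam ^ N = lam ^ (N - K) * lam ^ K := by rw [← pow_add, Nat.sub_add_cancel hKN]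
    rw [div_le_iff₀ (by positivity), hpow, hθ, hN]
    push_cast
    have hp : 0 < lam ^ (m * d - K) := pow_pos hl _
    have : C * (m * d) * lam ^ K ≤ (ε * m / 2) ^ 2 := by nlinarith
    calc _ = lam ^ (m * d - K) * (C * (m * d) * lam ^ K) := by ring
      _ ≤ _ := by gcongr
  obtain ⟨φ, hloop, hpre, hgood, hbad⟩ := hG N K B hBcard
  have hN0' : (0 : ℝ) < N := by exact_mod_cast hN0
  refine isCompressible_of_code (a₀ := x 0) (φ := φ) (c := (N - 1) / N) hN0
    (fun z hz i => hloop _ (window_mem_paths hz i N))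
    (fun z hz z' hz' i j => hpre _ (window_mem_paths hz i N) _ (window_mem_paths hz' j N))
    ((div_lt_one hN0').2 (by linarith)) ((hfreq m hm0').mono fun n hn => ?_)
  have hsub : ((Finset.range n).filter fun i => ε * m ≤
      |∑ j ∈ Finset.range m, deviation (parryMatrix M lam r) w b x ((i * m + j) * d)|) ⊆
      (Finset.range n).filter fun i => window x (i * N) N ∈ B := by
    intro i hi
    rw [Finset.mem_filter] at hi ⊢
    refine ⟨hi.1, Finset.mem_filter.2 ⟨window_mem_paths hx _ _, ?_⟩⟩
    have h1 := abs_pathSum_sub_le (w := w) (b := b) hP0 hP1 hd x i m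
    have h2 := abs_sub_abs_le_abs_sub
      (∑ j ∈ Finset.range m, deviation (parryMatrix M lam r) w b x ((i * m + j) * d))
      (pathSum D (window x (i * N) N))
    rw [abs_sub_comm] at h2
    have h3 := hi.2
    rw [hθ]
    linarith
  have hn' : ε * n ≤ (((Finset.range n).filter fun i => window x (i * N) N ∈ B).card : ℝ) :=
    hn.trans (by exact_mod_cast Finset.card_le_card hsub)
  rw [length_concatPrefix]
  push_cast
  calc ∑ i ∈ Finset.range n, ((codeBlocks N φ x i).length : ℝ)
      ≤ ∑ i ∈ Finset.range n, ((N + G : ℝ) - if window x (i * N) N ∈ B then (K : ℝ) else 0) := by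
        refine Finset.sum_le_sum fun i _ => ?_
        have hp := window_mem_paths hx (i * N) N
        split_ifs with hi
        · have := hbad _ hp hi
          have h1 : ((codeBlocks N φ x i).length : ℝ) ≤ ((N - K + G : ℕ) : ℝ) := by
            exact_mod_cast this
          rw [Nat.cast_add, Nat.cast_sub hKN] at h1
          linarith
        · have := hgood _ hp hi
          have h1 : ((codeBlocks N φ x i).length : ℝ) ≤ ((N + G : ℕ) : ℝ) := by
            exact_mod_cast this
          rw [Nat.cast_add] at h1
          linarith
    _ = n * (N + G) - ((Finset.range n).filter fun i => window x (i * N) N ∈ B).card * K := by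
        rw [Finset.sum_sub_distrib, ← Finset.sum_filter, Finset.sum_const, Finset.sum_const,
          Finset.card_range, nsmul_eq_mul, nsmul_eq_mul]
    _ ≤ n * (N + G) - ε * n * K := by gcongr
    _ ≤ n * (N - 1) := by
        have hn0 : (0 : ℝ) ≤ n := Nat.cast_nonneg n
        nlinarith
    _ = (N - 1) / N * (n * N) := by field_simp

end Deviation

/-! ### From transition frequencies to normality -/

section Frequencies

variable {A : Type*} [DecidableEq A]

/-- Two invariant distributions of `B` agree, if one of them is positive and `B` is irreducible:
subtract the largest multiple of the positive one that leaves a nonnegative vector. -/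
theorem eq_of_vecMul_eq [Fintype A] {B : Matrix A A ℝ} (hB0 : ∀ a b, 0 ≤ B a b)
    (hB : ∀ a b, ∃ k, 0 < (B ^ k) a b) {π ρ : A → ℝ} (hπ : ∀ a, 0 < π a)
    (hπB : Matrix.vecMul π B = π) (hρB : Matrix.vecMul ρ B = ρ) (hπ1 : ∑ a, π a = 1)
    (hρ1 : ∑ a, ρ a = 1) : ρ = π := by
  have : Nonempty A := by
    by_contra h
    rw [not_nonempty_iff] at h
    simp at hπ1
  obtain ⟨b, -, hb⟩ := Finset.exists_min_image Finset.univ (fun a => ρ a / π a)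
    Finset.univ_nonempty
  set t := ρ b / π b with ht
  set z : A → ℝ := ρ - t • π with hz
  have hz0 : ∀ a, 0 ≤ z a := fun a => by
    have := (le_div_iff₀ (hπ a)).1 (hb a (Finset.mem_univ a))
    simpa [hz] using this
  have hzb : z b = 0 := by simp [hz, ht, div_mul_cancel₀ _ (hπ b).ne']
  have hzB : ∀ k : ℕ, Matrix.vecMul z (B ^ k) = z := by
    intro k
    induction k with
    | zero => simp
    | succ k ih => rw [pow_succ, ← Matrix.vecMul_vecMul, ih, hz, Matrix.sub_vecMul,
        Matrix.smul_vecMul, hπB, hρB]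
  have hz1 : ∀ a, z a = 0 := by
    intro a
    obtain ⟨k, hk⟩ := hB a b
    have h1 : ∑ c, z c * (B ^ k) c b = 0 := (congrFun (hzB k) b).trans hzb
    have h2 := (Finset.sum_eq_zero_iff_of_nonneg fun c _ =>
      mul_nonneg (hz0 c) (Matrix.pow_apply_nonneg hB0 k c b)).1 h1 a (Finset.mem_univ a)
    exact (mul_eq_zero.1 h2).resolve_right hk.ne'
  have hρ : ∀ a, ρ a = t * π a := fun a => sub_eq_zero.1 (by simpa [hz] using hz1 a)
  have ht1 : t = 1 := by
    rw [← hρ1, Finset.sum_congr rfl fun a _ => hρ a, ← Finset.mul_sum, hπ1, mul_one]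
  exact funext fun a => by rw [hρ a, ht1, one_mul]

/-- The frequency of the word `w` among the first `n` positions of `x` that are divisible by `d`. -/
noncomputable def freq (x : ℕ → A) (d : ℕ) (w : List A) (n : ℕ) : ℝ :=
  (((Finset.range n).filter fun j => window x (j * d) w.length = w).card : ℝ) / n

theorem freq_nonneg (x : ℕ → A) (d : ℕ) (w : List A) (n : ℕ) : 0 ≤ freq x d w n := by
  rw [freq]
  positivity

theorem freq_le_one (x : ℕ → A) (d : ℕ) (w : List A) (n : ℕ) : freq x d w n ≤ 1 := by
  refine div_le_one_of_le₀ ?_ (Nat.cast_nonneg n)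
  exact_mod_cast (Finset.card_filter_le _ _).trans (Finset.card_range n).le

theorem sum_deviation_div (P : Matrix A A ℝ) (x : ℕ → A) (d : ℕ) (w : List A) (b : A) (n : ℕ) :
    (∑ j ∈ Finset.range n, deviation P w b x (j * d)) / n =
      freq x d (w ++ [b]) n - P (w.getLastD b) b * freq x d w n := by
  have h : ∀ p, deviation P w b x p = (if window x p (w ++ [b]).length = w ++ [b] then 1 else 0) -
      P (w.getLastD b) b * if window x p w.length = w then 1 else 0 := by
    intro p
    have : window x p (w ++ [b]).length = w ++ [b] ↔
        window x p w.length = w ∧ x (p + w.length) = b := by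
      rw [List.length_append, List.length_singleton, window_succ]
      constructor
      · intro h
        obtain ⟨h1, h2⟩ := List.append_inj' h rfl
        exact ⟨h1, List.singleton_inj.1 h2⟩
      · rintro ⟨h1, h2⟩
        rw [h1, h2]
    rw [deviation]
    simp only [this]
    by_cases h1 : window x p w.length = w <;> simp [h1]
  simp_rw [h]
  rw [Finset.sum_sub_distrib, ← Finset.mul_sum, Finset.sum_boole, Finset.sum_boole, freq, freq]
  ring

theorem sum_words_card_filter [Fintype A] (x : ℕ → A) (d n k : ℕ) (p : ℕ → Prop)
    [DecidablePred p] :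
    ∑ u ∈ words A k, (((Finset.range n).filter fun j => window x (j * d) k = u ∧ p j).card : ℝ) =
      ((Finset.range n).filter p).card := by
  rw [Finset.card_eq_sum_card_fiberwise (f := fun j => window x (j * d) k) (t := words A k)
    fun j _ => by simp]
  push_cast
  refine Finset.sum_congr rfl fun u _ => ?_
  rw [Finset.filter_filter]
  simp only [and_comm]

/-- The frequencies of the words `u b` with `u` of length `d` add up to the frequency of `b`, up to
the first and the last position. -/
theorem tendsto_sum_freq_concat_sub [Fintype A] (x : ℕ → A) (d : ℕ) (b : A) :
    Tendsto (fun n => ∑ u ∈ words A d, freq x d (u ++ [b]) n - freq x d [b] n) atTop (𝓝 0) := by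
  set I : ℕ → ℝ := fun j => if x (j * d) = b then 1 else 0 with hI
  have h1 : ∀ n : ℕ, ∑ u ∈ words A d, freq x d (u ++ [b]) n - freq x d [b] n =
      (I n - I 0) / n := by
    intro n
    have e1 : freq x d [b] n = (∑ j ∈ Finset.range n, I j) / n := by
      rw [freq, hI, Finset.sum_boole]
      simp [window]
    have e2 : ∑ u ∈ words A d, freq x d (u ++ [b]) n = (∑ j ∈ Finset.range n, I (j + 1)) / n := by
      simp only [freq, ← Finset.sum_div]
      congr 1
      rw [hI, Finset.sum_boole]
      rw [← sum_words_card_filter x d n d]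
      refine Finset.sum_congr rfl fun u hu => ?_
      congr 2
      ext j
      rw [Finset.mem_filter, Finset.mem_filter, List.length_append, mem_words.1 hu,
        List.length_singleton, window_succ, Nat.succ_mul]
      refine and_congr_right fun _ => ⟨fun h => ?_, fun h => by rw [h.1, h.2]⟩
      obtain ⟨h1, h2⟩ := List.append_inj' h rfl
      exact ⟨h1, List.singleton_inj.1 h2⟩
    rw [e1, e2, ← sub_div, ← Finset.sum_sub_distrib, Finset.sum_range_sub]
  refine squeeze_zero_norm (a := fun n : ℕ => (1 : ℝ) / n) (fun n => ?_)
    tendsto_one_div_atTop_nhds_zero_nat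
  rw [h1, Real.norm_eq_abs, abs_div, Nat.abs_cast]
  gcongr
  simp only [hI]
  split_ifs <;> simp

theorem sum_freq_singleton [Fintype A] (x : ℕ → A) (d : ℕ) {n : ℕ} (hn : 0 < n) :
    ∑ a, freq x d [a] n = 1 := by
  have hn' : (n : ℝ) ≠ 0 := by exact_mod_cast hn.ne'
  simp only [freq, ← Finset.sum_div]
  rw [div_eq_one_iff_eq hn']
  norm_cast
  conv_rhs => rw [← Finset.card_range n, Finset.card_eq_sum_card_fiberwise
    (f := fun j => x (j * d)) (t := Finset.univ) fun j _ => by simp]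
  simp [window]

variable {P : Matrix A A ℝ} {x : ℕ → A} {d : ℕ}

theorem tendsto_freq_cons_sub
    (hdev : ∀ (w : List A) (b : A), w ≠ [] → Tendsto (fun n : ℕ =>
      (∑ j ∈ Finset.range n, deviation P w b x (j * d)) / n) atTop (𝓝 0)) (a : A) (u : List A) :
    Tendsto (fun n => freq x d (a :: u) n - freq x d [a] n * pathProb P a u) atTop (𝓝 0) := by
  induction u using List.reverseRecOn with
  | nil => simp [pathProb]
  | append_singleton u b ih =>
    have h1 := hdev (a :: u) b (List.cons_ne_nil a u)
    simp only [sum_deviation_div, List.getLastD_cons] at h1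
    have h2 := h1.add (ih.const_mul (P (u.getLastD a) b))
    rw [mul_zero, add_zero] at h2
    refine h2.congr fun n => ?_
    rw [pathProb_concat, List.cons_append]
    ring

/-- A limit of letter frequencies along a subsequence is an invariant distribution of `P ^ d`, so it
is `π`; this determines the limits for all words. -/
theorem tendsto_freq [Fintype A] (hP0 : ∀ a b, 0 ≤ P a b) (hd : 1 ≤ d)
    (hconn : ∀ a b, ∃ k, 0 < ((P ^ d) ^ k) a b) {π : A → ℝ} (hπ : ∀ a, 0 < π a)
    (hπP : Matrix.vecMul π P = π) (hπ1 : ∑ a, π a = 1)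
    (hdev : ∀ (w : List A) (b : A), w ≠ [] → Tendsto (fun n : ℕ =>
      (∑ j ∈ Finset.range n, deviation P w b x (j * d)) / n) atTop (𝓝 0)) (w : List A) :
    Tendsto (freq x d w) atTop (𝓝 (markovMeasure π P w)) := by
  have hπd : ∀ k : ℕ, Matrix.vecMul π (P ^ k) = π := by
    intro k
    induction k with
    | zero => simp
    | succ k ih => rw [pow_succ, ← Matrix.vecMul_vecMul, ih, hπP]
  have hinv : ∀ b, Tendsto (fun n => ∑ a, freq x d [a] n * (P ^ d) a b - freq x d [b] n) atTop
      (𝓝 0) := by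
    intro b
    obtain ⟨e, rfl⟩ : ∃ e, d = e + 1 := ⟨d - 1, by lia⟩
    have h1 := tendsto_finsetSum (Finset.univ : Finset A) fun a _ =>
      tendsto_finsetSum (words A e) fun u _ => tendsto_freq_cons_sub hdev a (u ++ [b])
    simp only [Finset.sum_const_zero] at h1
    have h2 := (tendsto_sum_freq_concat_sub x (e + 1) b).sub h1
    rw [sub_zero] at h2
    refine h2.congr fun n => ?_
    simp only [Finset.sum_sub_distrib, ← Finset.mul_sum, sum_pathProb_concat]
    rw [sum_words_succ']
    simp only [List.cons_append]
    ring
  have hlet : Tendsto (fun n a => freq x d [a] n) atTop (𝓝 π) := by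
    refine tendsto_of_subseq_tendsto fun ns hns => ?_
    obtain ⟨ρ, -, ms, hms, hρ⟩ := (isCompact_Icc (a := (0 : A → ℝ)) (b := 1)).tendsto_subseq
      (x := fun n a => freq x d [a] (ns n))
      fun n => ⟨fun a => freq_nonneg x d [a] _, fun a => freq_le_one x d [a] _⟩
    have hρa : ∀ a, Tendsto (fun n => freq x d [a] (ns (ms n))) atTop (𝓝 (ρ a)) :=
      fun a => (tendsto_pi_nhds.1 hρ) a
    have hsub : Tendsto (fun n => ns (ms n)) atTop atTop := hns.comp hms.tendsto_atTop
    have hρ1 : ∑ a, ρ a = 1 := by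
      refine tendsto_nhds_unique (tendsto_finsetSum Finset.univ fun a _ => hρa a) ?_
      refine tendsto_const_nhds.congr' ?_
      filter_upwards [hsub.eventually_gt_atTop 0] with n hn
      rw [sum_freq_singleton x d hn]
    have hρP : Matrix.vecMul ρ (P ^ d) = ρ := by
      funext b
      have h1 := (tendsto_finsetSum Finset.univ fun a _ =>
        (hρa a).mul_const ((P ^ d) a b)).sub (hρa b)
      exact sub_eq_zero.1 (tendsto_nhds_unique h1 ((hinv b).comp hsub))
    have := eq_of_vecMul_eq (Matrix.pow_apply_nonneg hP0 d) hconn hπ (hπd d) hρP hπ1 hρ1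
    exact ⟨ms, this ▸ hρ⟩
  rcases w with _ | ⟨a, u⟩
  · refine tendsto_const_nhds.congr' ?_
    filter_upwards [eventually_gt_atTop 0] with n hn
    have hn' : (n : ℝ) ≠ 0 := by exact_mod_cast hn.ne'
    simp [freq, markovMeasure, hn']
  · have h1 := (tendsto_freq_cons_sub hdev a u).add
      (((tendsto_pi_nhds.1 hlet) a).mul_const (pathProb P a u))
    rw [zero_add] at h1
    exact h1.congr fun n => by ring

end Frequencies

/-! ### Counting occurrences -/

section Occurrences

variable {A : Type*} [DecidableEq A]

theorem alignedOcc_div_eq_freq (x : ℕ → A) {w : List A} (hw : 1 ≤ w.length) (n : ℕ) :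
    (alignedOcc (seqPrefix x (n * w.length)) w : ℝ) / n = freq x w.length w n := by
  rw [freq, alignedOcc]
  congr 2
  symm
  refine Finset.card_bij (fun j _ => j * w.length) ?_ ?_ ?_
  · intro j hj
    rw [Finset.mem_filter, Finset.mem_range] at hj
    have hle : (j + 1) * w.length ≤ n * w.length := Nat.mul_le_mul_right _ hj.1
    rw [Nat.succ_mul] at hle
    rw [Finset.mem_filter, Finset.mem_range, seqPrefix_eq_window, length_window,
      drop_window x 0 (by lia), prefix_window_iff, zero_add]
    exact ⟨by lia, dvd_mul_left _ _, by lia, hj.2⟩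
  · intro j _ j' _ h
    exact Nat.eq_of_mul_eq_mul_right hw h
  · intro i hi
    rw [Finset.mem_filter, Finset.mem_range, seqPrefix_eq_window, length_window] at hi
    obtain ⟨hi, ⟨j, rfl⟩, hpre⟩ := hi
    rw [drop_window x 0 (by lia), prefix_window_iff, zero_add, mul_comm w.length j] at hpre
    refine ⟨j, ?_, mul_comm _ _⟩
    rw [Finset.mem_filter, Finset.mem_range]
    refine ⟨lt_of_mul_lt_mul_right (a := w.length) ?_ (Nat.zero_le _), hpre.2⟩
    lia

theorem tendsto_occ_div_sub_freq (x : ℕ → A) (w : List A) :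
    Tendsto (fun n : ℕ => (occ (seqPrefix x n) w : ℝ) / n - freq x 1 w n) atTop (𝓝 0) := by
  set S : ℕ → Finset ℕ := fun n =>
    (Finset.range n).filter fun j => window x (j * 1) w.length = w with hS
  have hmem : ∀ n i, i ∈ (Finset.range ((seqPrefix x n).length + 1)).filter
      (fun i => w <+: (seqPrefix x n).drop i) ↔ i + w.length ≤ n ∧ window x i w.length = w := by
    intro n i
    rw [Finset.mem_filter, Finset.mem_range, seqPrefix_eq_window, length_window]
    constructor
    · rintro ⟨h1, h2⟩
      rw [drop_window x 0 (by lia), prefix_window_iff, zero_add] at h2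
      exact ⟨by lia, h2.2⟩
    · rintro ⟨h1, h2⟩
      rw [drop_window x 0 (by lia), prefix_window_iff, zero_add]
      exact ⟨by lia, by lia, h2⟩
  have h1 : ∀ n, occ (seqPrefix x n) w ≤ (S n).card + (w.length + 1) := by
    intro n
    rw [occ]
    refine (Finset.card_le_card (t := S n ∪ {n}) fun i hi => ?_).trans
      ((Finset.card_union_le _ _).trans (by simp))
    rw [hmem] at hi
    rw [Finset.mem_union, Finset.mem_singleton, hS, Finset.mem_filter, Finset.mem_range, mul_one]
    rcases eq_or_ne i n with rfl | hne
    · exact Or.inr rfl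
    · exact Or.inl ⟨by lia, hi.2⟩
  have h2 : ∀ n, (S n).card ≤ occ (seqPrefix x n) w + (w.length + 1) := by
    intro n
    rw [occ]
    refine (Finset.card_le_card (t := _ ∪ Finset.Ico (n - w.length) n) fun i hi => ?_).trans
      ((Finset.card_union_le _ _).trans (Nat.add_le_add_left (by simp; lia) _))
    rw [hS, Finset.mem_filter, Finset.mem_range, mul_one] at hi
    rw [Finset.mem_union, hmem, Finset.mem_Ico]
    by_cases hin : i + w.length ≤ n
    · exact Or.inl ⟨hin, hi.2⟩
    · exact Or.inr ⟨by lia, hi.1⟩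
  refine squeeze_zero_norm (a := fun n : ℕ => ((w.length + 1 : ℕ) : ℝ) / n) (fun n => ?_)
    (tendsto_const_div_atTop_nhds_zero_nat _)
  rw [freq, ← sub_div, Real.norm_eq_abs, abs_div, Nat.abs_cast]
  gcongr
  have h1' : (occ (seqPrefix x n) w : ℝ) ≤ (S n).card + (w.length + 1 : ℕ) := by
    exact_mod_cast h1 n
  have h2' : ((S n).card : ℝ) ≤ occ (seqPrefix x n) w + (w.length + 1 : ℕ) := by
    exact_mod_cast h2 n
  rw [abs_le]
  constructor <;> linarith

theorem isNormal_iff [Fintype A] {M : Matrix A A ℝ} {x : ℕ → A} :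
    IsNormal M x ↔ ∃ μ : List A → ℝ, IsParryMeasure M μ ∧ ∀ w : List A, 1 ≤ w.length →
      Tendsto (freq x w.length w) atTop (𝓝 (μ w)) := by
  refine exists_congr fun μ => and_congr_right fun _ => ⟨fun h w hw => ?_, ?_⟩
  · exact (h w.length hw w rfl).congr fun n => alignedOcc_div_eq_freq x hw n
  · rintro h ℓ hℓ w rfl
    exact (h w hℓ).congr fun n => (alignedOcc_div_eq_freq x hℓ n).symm

theorem isNonAlignedNormal_iff [Fintype A] {M : Matrix A A ℝ} {x : ℕ → A} :
    IsNonAlignedNormal M x ↔ ∃ μ : List A → ℝ, IsParryMeasure M μ ∧ ∀ w : List A,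
      Tendsto (freq x 1 w) atTop (𝓝 (μ w)) := by
  refine exists_congr fun μ => and_congr_right fun _ => forall_congr' fun w =>
    ⟨fun h => ?_, fun h => ?_⟩
  · simpa using h.sub (tendsto_occ_div_sub_freq x w)
  · simpa using (tendsto_occ_div_sub_freq x w).add h

end Occurrences

/-! ### Normality and incompressibility -/

section Main

variable {A : Type*} [Fintype A] [DecidableEq A] [Nontrivial A] {M : Matrix A A ℝ} {x : ℕ → A}

/-- The freedom in the choice of `s` covers both aligned occurrences (`s = N`) and arbitrary
occurrences (`s = 1`). -/
theorem isIncompressible_of_tendsto_freq (hM : ∀ a b, M a b = 0 ∨ M a b = 1)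
    (hirr : M.IsIrreducible) (hbr : ∃ a b b', b ≠ b' ∧ M a b = 1 ∧ M a b' = 1) (hx : x ∈ sft M)
    {μ : List A → ℝ} (hμ : IsParryMeasure M μ)
    (hfreq : ∀ N ≥ 1, ∃ s k, 1 ≤ s ∧ N = s * k ∧ ∀ u, u.length = N →
      Tendsto (freq x s u) atTop (𝓝 (μ u))) : IsIncompressible (sft M) x := by
  obtain ⟨lam, l, r, h, hl, -, hs, rfl⟩ := hμ.exists_isPerron hM hirr hbr
  obtain ⟨c, hc, hb⟩ := h.exists_pathProb_bounds
  have hlam := h.lam_pos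
  refine h.isIncompressible hx (μ := markovMeasure (fun a => l a * r a) (parryMatrix M lam r))
    (C := lam / c) (by positivity) (fun u hu => ?_) (fun N hN => ?_)
  · obtain ⟨a, u, rfl⟩ := List.exists_cons_of_ne_nil hu
    have h1 : l a * r a ≤ 1 := hs ▸ Finset.single_le_sum (f := fun a => l a * r a)
      (fun b _ => (mul_pos (hl b) (h.pos b)).le) (Finset.mem_univ a)
    calc l a * r a * pathProb (parryMatrix M lam r) a u
        ≤ 1 * (1 / (c * lam ^ u.length)) := mul_le_mul h1 (hb a u).1
          (pathProb_nonneg h.parryMatrix_nonneg a u) zero_le_one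
      _ = lam / c / lam ^ (a :: u).length := by
          rw [List.length_cons, pow_succ]
          field_simp
  · obtain ⟨s, k, hs, hN, hf⟩ := hfreq N hN
    refine ⟨s, k, hs, hN, fun u hu => ?_⟩
    exact (hf u hu).congr fun n => by rw [freq, hu]

theorem tendsto_freq_of_isIncompressible (hM : ∀ a b, M a b = 0 ∨ M a b = 1)
    (hirr : M.IsIrreducible) (hbr : ∃ a b b', b ≠ b' ∧ M a b = 1 ∧ M a b' = 1) (hx : x ∈ sft M)
    (hinc : IsIncompressible (sft M) x) :
    ∃ μ : List A → ℝ, IsParryMeasure M μ ∧ ∀ d ≥ 1, (∀ a b, ∃ k, 0 < (M ^ (d * k)) a b) →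
      ∀ w, Tendsto (freq x d w) atTop (𝓝 (μ w)) := by
  obtain ⟨μ, hμ⟩ := exists_isParryMeasure hirr
  refine ⟨μ, hμ, fun d hd hconn w => ?_⟩
  obtain ⟨lam, l, r, h, hl, hlM, hs, rfl⟩ := hμ.exists_isPerron hM hirr hbr
  refine tendsto_freq h.parryMatrix_nonneg hd (fun a b => ?_) (fun a => mul_pos (hl a) (h.pos a))
    ?_ hs (fun w b hw => h.tendsto_deviation hirr hx hinc hd hw b) w
  · obtain ⟨k, hk⟩ := hconn a b
    refine ⟨k, ?_⟩
    rw [← pow_mul, h.parryMatrix_pow_apply]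
    exact div_pos (mul_pos hk (h.pos b)) (mul_pos (pow_pos h.lam_pos _) (h.pos a))
  · funext b
    have hlam := h.lam_pos.ne'
    have h1 : ∀ a, l a * r a * parryMatrix M lam r a b = l a * M a b * (r b / lam) := by
      intro a
      have := (h.pos a).ne'
      rw [parryMatrix]
      field_simp
    calc ∑ a, l a * r a * parryMatrix M lam r a b = l b * r b := by
          simp_rw [h1, ← Finset.sum_mul, hlM]
          field_simp

end Main

end NormalSFT

theorem mainTheorem1 {A : Type*} [Fintype A] [DecidableEq A] [Nontrivial A]
    (M : Matrix A A ℝ) (hM : ∀ a b, M a b = 0 ∨ M a b = 1) (hirr : M.IsIrreducible)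
    (x : ℕ → A) (hx : x ∈ NormalSFT.sft M) :
    (M.IsPrimitive →
      (NormalSFT.IsNormal M x ↔ NormalSFT.IsIncompressible (NormalSFT.sft M) x)) ∧
    ((NormalSFT.sft M).Infinite →
      (NormalSFT.IsNonAlignedNormal M x ↔ NormalSFT.IsIncompressible (NormalSFT.sft M) x)) := by
  rw [NormalSFT.isNormal_iff, NormalSFT.isNonAlignedNormal_iff]
  refine ⟨fun hprim => ?_, fun hinf => ?_⟩
  · have hbr := NormalSFT.exists_two_successors_of_isPrimitive hM hprim
    constructor
    · rintro ⟨μ, hμ, hf⟩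
      exact NormalSFT.isIncompressible_of_tendsto_freq hM hirr hbr hx hμ fun N hN =>
        ⟨N, 1, hN, (mul_one N).symm, fun u hu => by subst hu; exact hf u hN⟩
    · intro hinc
      obtain ⟨μ, hμ, hf⟩ := NormalSFT.tendsto_freq_of_isIncompressible hM hirr hbr hx hinc
      refine ⟨μ, hμ, fun w hw => hf w.length hw (fun a b => ?_) w⟩
      obtain ⟨k, hk, hpos⟩ := hprim.exists_pos_pow
      -- every positive power of a positive matrix is positive
      have hpow : ∀ m : ℕ, ∀ a b, 0 < (M ^ (k * (m + 1))) a b := by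
        intro m
        induction m with
        | zero => simpa using hpos
        | succ m ih =>
          intro a b
          rw [Nat.mul_succ, pow_add, Matrix.mul_apply]
          exact Finset.sum_pos (fun c _ => mul_pos (ih a c) (hpos c b)) Finset.univ_nonempty
      refine ⟨k, ?_⟩
      have := hpow (w.length - 1) a b
      rwa [Nat.sub_add_cancel hw, mul_comm] at this
  · have hbr := NormalSFT.exists_two_successors_of_infinite hinf
    constructor
    · rintro ⟨μ, hμ, hf⟩
      exact NormalSFT.isIncompressible_of_tendsto_freq hM hirr hbr hx hμ fun N _ =>
        ⟨1, N, le_rfl, (one_mul N).symm, fun u _ => hf u⟩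
    · intro hinc
      obtain ⟨μ, hμ, hf⟩ := NormalSFT.tendsto_freq_of_isIncompressible hM hirr hbr hx hinc
      refine ⟨μ, hμ, fun w => hf 1 le_rfl (fun a b => ?_) w⟩
      obtain ⟨k, -, hk⟩ := (Matrix.isIrreducible_iff_exists_pow_pos hirr.nonneg).1 hirr a b
      exact ⟨k, by rwa [one_mul]⟩
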